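/- **Setting.** Let $t_1,t_2,r_1,r_2\ge 1$. In the Gaussian MIMO cognitive radio channel the primary and the cognitive receiver observe $$Y_1=H_{11}X_1+H_{21}X_2+Z_1,\qquad Y_2=H_{12}X_1+H_{22}X_2+Z_2,$$ where $H_{ij}$ is a random $r_j\times t_i$ complex matrix and $Z_j\sim\mathcal{CN}(0,I_{r_j})$. The cognitive transmitter (input $X_2$) knows the primary message non-causally. The receivers know the channel matrices; the transmitters know only their distribution (no CSIT). Put $\bar H_1=[H_{11}\ H_{21}]$ and $\bar H_2=[H_{12}\ H_{22}]$. In the dirty paper coding scheme $X_2=X_{21}+X_{22}$, where $[X_1;X_{21}]\sim\mathcal{CN}(0,\Sigma)$ with $\Sigma=\begin{bmatrix}\Sigma_1&V\\V^*&\Sigma_{21}\end{bmatrix}=T_1T_1^*$ is independent of $X_{22}=T_2X_{22}'$, where $X_{22}'\sim\mathcal{CN}(0,I_{t_2})$ and $\Sigma_{22}=T_2T_2^*$, with $T_1$ and $T_2$ square; the auxiliary variable is $U=X_{22}'+W[X_1;X_{21}]$, with a $t_2\times(t_1+t_2)$ inflation factor $W$. The power constraints are $\mathrm{tr}\,\Sigma_1\le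 P_p$ and $\mathrm{tr}(\Sigma_{21}+\Sigma_{22})\le P_c$. The scheme achieves the sum-rate $R_{sum}=R_p+R_c$, where $$R_p=\mathbb E\log\frac{|I_{r_1}+\bar H_1\Sigma\bar H_1^*+H_{21}\Sigma_{22}H_{21}^*|}{|I_{r_1}+H_{21}\Sigma_{22}H_{21}^*|},\qquad R_c=\mathbb E\log\frac{|B|}{\left|\begin{matrix}I_{t_2}+W\Sigma W^*&T_2^*H_{22}^*+W\Sigma\bar H_2^*\\H_{22}T_2+\bar H_2\Sigma W^*&B\end{matrix}\right|},$$ with $B=I_{r_2}+H_{22}\Sigma_{22}H_{22}^*+\bar H_2\Sigma\bar H_2^*$; here $T_1,T_2,W$ do not depend on the realization of the channel. Let $\Sigma'$ be the covariance matrix of $[X_1;X_2]$. **Theorem 2 (CRC).** Assume that the channel matrices $H_{ij}$ are almost surely of full rank and mutually independent, that $\mathbb E\log(1+\|H_{ij}\|^2)<\infty$, and that the fading is generic: for $j=1,2$ and every positive semidefinite $A$, $\mathrm{rank}(\bar H_jA\bar H_j^*)=\min(r_j,\mathrm{rank}\,A)$ with probability $1$. Let the ratio $P_p/P_c>0$ be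 held constant. Then all the expectations above are finite, and the high-SNR sum-rate scaling factor achievable with this scheme over the no-CSIT CRC, $$\lim_{P_p\to\infty}\frac{1}{\log P_p}\ \sup_{T_1,T_2,W}R_{sum}$$ (the supremum, finite for every $P_p>0$, being over all $T_1,T_2,W$ that satisfy the power constraints), exists and equals $$\gamma_{sum}=\max_{\mathrm{rank}(\Sigma'),\,\mathrm{rank}(\Sigma_{22})}(\gamma_p+\gamma_c),$$ $$\gamma_p=\min(r_1,\mathrm{rank}\,\Sigma')-\min(r_1,\mathrm{rank}\,\Sigma_{22}),\qquad \gamma_c=\min(r_2,\mathrm{rank}\,\Sigma')-\min(r_2,\mathrm{rank}\,\Sigma'-\mathrm{rank}\,\Sigma_{22}),$$ where the maximum is over the integer values $0<\mathrm{rank}\,\Sigma'\le t_1+t_2$ and $0\le\mathrm{rank}\,\Sigma_{22}\le\min(t_2,\mathrm{rank}\,\Sigma')$. Moreover, for any fixed matrices $T_1,T_2$, using $\sqrt{P_p}\,T_1$, $\sqrt{P_p}\,T_2$ and the inflation factor $W=[0\ \ (\sqrt{P_p}\,T_2)^+]$ at power $P_p$ (with $^+$ the Moore–Penrose pseudo-inverse),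 one has $R_p/\log P_p\to\gamma_p$ and $R_c/\log P_p\to\gamma_c$ as $P_p\to\infty$; and every pair of ranks admitted in the maximum is attained by matrices $T_1,T_2$ such that $\sqrt{P_p}\,T_1$, $\sqrt{P_p}\,T_2$ satisfy the power constraints for every $P_p>0$. -/

import Mathlib

open MeasureTheory ProbabilityTheory Filter Topology Matrix
open scoped ComplexOrder

noncomputable section

/-- The antennas of both transmitters: those of the primary transmitter in the first summand, those
of the cognitive transmitter in the second. -/
abbrev TxIndex (t₁ t₂ : ℕ) : Type := Fin t₁ ⊕ Fin t₂

/-- The Moore-Penrose pseudo-inverse of a complex matrix, `A⁺ = (Aᴴ A)⁺ Aᴴ`, where `(Aᴴ A)⁺` inverts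
the nonzero eigenvalues of the Hermitian matrix `Aᴴ A` and keeps the zero ones. -/
def pinv {m n : ℕ} (A : Matrix (Fin m) (Fin n) ℂ) : Matrix (Fin n) (Fin m) ℂ :=
  let hA : (Aᴴ * A).IsHermitian := isHermitian_conjTranspose_mul_self A
  (hA.eigenvectorUnitary : Matrix (Fin n) (Fin n) ℂ)
    * diagonal (fun i => ((hA.eigenvalues i)⁻¹ : ℂ))
    * (hA.eigenvectorUnitary : Matrix (Fin n) (Fin n) ℂ)ᴴ * Aᴴ

/-- The four Penrose equations, which characterize the pseudo-inverse. -/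
theorem pinv_penrose {m n : ℕ} (A : Matrix (Fin m) (Fin n) ℂ) :
    A * pinv A * A = A ∧ pinv A * A * pinv A = pinv A ∧
      (A * pinv A)ᴴ = A * pinv A ∧ (pinv A * A)ᴴ = pinv A * A := by
  set hA : (Aᴴ * A).IsHermitian := isHermitian_conjTranspose_mul_self A with hhA
  set U : Matrix (Fin n) (Fin n) ℂ := (hA.eigenvectorUnitary : Matrix (Fin n) (Fin n) ℂ) with hU
  set D : Matrix (Fin n) (Fin n) ℂ := diagonal (fun i => (hA.eigenvalues i : ℂ)) with hD
  set E : Matrix (Fin n) (Fin n) ℂ := diagonal (fun i => ((hA.eigenvalues i)⁻¹ : ℂ)) with hE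
  have hp : pinv A = U * E * Uᴴ * Aᴴ := rfl
  have hUU : Uᴴ * U = 1 := by
    have := Unitary.coe_star_mul_self hA.eigenvectorUnitary
    simpa [hU, star_eq_conjTranspose] using this
  have hG : Aᴴ * A = U * D * Uᴴ := by
    have := hA.spectral_theorem
    rw [Unitary.conjStarAlgAut_apply] at this
    simpa [hU, hD, star_eq_conjTranspose, Function.comp_def] using this
  have hDE : D * E * D = D := by
    simp only [hD, hE, diagonal_mul_diagonal]
    congr 1; funext i
    exact mul_inv_mul_cancel (hA.eigenvalues i : ℂ)
  have hED : E * D * E = E := by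
    simp only [hD, hE, diagonal_mul_diagonal]
    congr 1; funext i
    rcases eq_or_ne (hA.eigenvalues i : ℂ) 0 with h | h
    · simp [h]
    · rw [inv_mul_cancel₀ h, one_mul]
  have hEh : Eᴴ = E := by
    simp only [hE, diagonal_conjTranspose]
    congr 1; funext i
    simp
  have hcomm : D * E = E * D := by
    simp only [hD, hE, diagonal_mul_diagonal]
    congr 1; funext i
    exact mul_comm _ _
  have hDh : Dᴴ = D := by
    simp only [hD, diagonal_conjTranspose]
    congr 1; funext i
    simp
  have hpA : pinv A * A = U * (E * D) * Uᴴ := by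
    calc pinv A * A = U * E * Uᴴ * (Aᴴ * A) := by rw [hp]; simp only [Matrix.mul_assoc]
      _ = U * E * (Uᴴ * U) * D * Uᴴ := by rw [hG]; simp only [Matrix.mul_assoc]
      _ = U * (E * D) * Uᴴ := by rw [hUU]; simp only [Matrix.mul_assoc, Matrix.one_mul]
  refine ⟨?_, ?_, ?_, ?_⟩
  · have h0 : Aᴴ * A * (pinv A * A - 1) = 0 := by
      have : Aᴴ * A * (pinv A * A) = Aᴴ * A := by
        calc Aᴴ * A * (pinv A * A) = U * D * (Uᴴ * U) * (E * D) * Uᴴ := by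
              rw [hpA, hG]; simp only [Matrix.mul_assoc]
          _ = U * (D * E * D) * Uᴴ := by rw [hUU]; simp only [Matrix.mul_assoc, Matrix.one_mul]
          _ = Aᴴ * A := by rw [hDE, hG]
      rw [Matrix.mul_sub, this, Matrix.mul_one, sub_self]
    rw [conjTranspose_mul_self_mul_eq_zero] at h0
    rw [Matrix.mul_sub, Matrix.mul_one, sub_eq_zero, ← Matrix.mul_assoc] at h0
    exact h0
  · calc pinv A * A * pinv A = U * (E * D) * (Uᴴ * U) * E * Uᴴ * Aᴴ := by
          rw [hpA, hp]; simp only [Matrix.mul_assoc]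
      _ = U * (E * D * E) * Uᴴ * Aᴴ := by rw [hUU]; simp only [Matrix.mul_assoc, Matrix.one_mul]
      _ = pinv A := by rw [hED, hp]
  · rw [hp]
    simp only [conjTranspose_mul, conjTranspose_conjTranspose, hEh, Matrix.mul_assoc]
  · rw [hpA]
    simp only [conjTranspose_mul, conjTranspose_conjTranspose, hEh, hDh, Matrix.mul_assoc]
    rw [← Matrix.mul_assoc D, hcomm, Matrix.mul_assoc]

/-- One realization of the four fading matrices; `Hᵢⱼ` maps the input of transmitter `i` to receiver
`j`, where `1` is the primary and `2` the cognitive user. -/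
structure ChannelState (t₁ t₂ r₁ r₂ : ℕ) where
  /-- primary transmitter to primary receiver -/
  H₁₁ : Matrix (Fin r₁) (Fin t₁) ℂ
  /-- primary transmitter to cognitive receiver -/
  H₁₂ : Matrix (Fin r₂) (Fin t₁) ℂ
  /-- cognitive transmitter to primary receiver -/
  H₂₁ : Matrix (Fin r₁) (Fin t₂) ℂ
  /-- cognitive transmitter to cognitive receiver -/
  H₂₂ : Matrix (Fin r₂) (Fin t₂) ℂ

namespace ChannelState

variable {t₁ t₂ r₁ r₂ : ℕ}

/-- `H̄₁ = [H₁₁ H₂₁]`, the joint channel to the primary receiver. -/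
def Hbar₁ (h : ChannelState t₁ t₂ r₁ r₂) : Matrix (Fin r₁) (TxIndex t₁ t₂) ℂ :=
  fromCols h.H₁₁ h.H₂₁

/-- `H̄₂ = [H₁₂ H₂₂]`, the joint channel to the cognitive receiver. -/
def Hbar₂ (h : ChannelState t₁ t₂ r₁ r₂) : Matrix (Fin r₂) (TxIndex t₁ t₂) ℂ :=
  fromCols h.H₁₂ h.H₂₂

/-- The primary rate for one channel realization: the primary receiver treats `X₂₂` as noise,
`log (|I + H̄₁ T₁ T₁* H̄₁* + H₂₁ T₂ T₂* H₂₁*| / |I + H₂₁ T₂ T₂* H₂₁*|)`. -/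
def primaryRate (h : ChannelState t₁ t₂ r₁ r₂)
    (T₁ : Matrix (TxIndex t₁ t₂) (TxIndex t₁ t₂) ℂ) (T₂ : Matrix (Fin t₂) (Fin t₂) ℂ) : ℝ :=
  Real.log
    ((1 + h.Hbar₁ * (T₁ * T₁ᴴ) * h.Hbar₁ᴴ + h.H₂₁ * (T₂ * T₂ᴴ) * h.H₂₁ᴴ).det.re
      / (1 + h.H₂₁ * (T₂ * T₂ᴴ) * h.H₂₁ᴴ).det.re)

/-- The covariance matrix of the output of the cognitive receiver. -/
def cognitiveOutputCov (h : ChannelState t₁ t₂ r₁ r₂)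
    (T₁ : Matrix (TxIndex t₁ t₂) (TxIndex t₁ t₂) ℂ) (T₂ : Matrix (Fin t₂) (Fin t₂) ℂ) :
    Matrix (Fin r₂) (Fin r₂) ℂ :=
  1 + h.H₂₂ * (T₂ * T₂ᴴ) * h.H₂₂ᴴ + h.Hbar₂ * (T₁ * T₁ᴴ) * h.Hbar₂ᴴ

/-- The joint covariance matrix of the auxiliary variable `U = X₂₂' + W [X₁; X₂₁]` and the output
of the cognitive receiver. -/
def dpcJointCov (h : ChannelState t₁ t₂ r₁ r₂)
    (T₁ : Matrix (TxIndex t₁ t₂) (TxIndex t₁ t₂) ℂ) (T₂ : Matrix (Fin t₂) (Fin t₂) ℂ)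
    (W : Matrix (Fin t₂) (TxIndex t₁ t₂) ℂ) :
    Matrix (Fin t₂ ⊕ Fin r₂) (Fin t₂ ⊕ Fin r₂) ℂ :=
  fromBlocks
    (1 + W * (T₁ * T₁ᴴ) * Wᴴ)
    (T₂ᴴ * h.H₂₂ᴴ + W * (T₁ * T₁ᴴ) * h.Hbar₂ᴴ)
    (h.H₂₂ * T₂ + h.Hbar₂ * (T₁ * T₁ᴴ) * Wᴴ)
    (h.cognitiveOutputCov T₁ T₂)

/-- The cognitive rate of dirty paper coding with inflation factor `W` for one channel
realization. -/
def cognitiveRate (h : ChannelState t₁ t₂ r₁ r₂)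
    (T₁ : Matrix (TxIndex t₁ t₂) (TxIndex t₁ t₂) ℂ) (T₂ : Matrix (Fin t₂) (Fin t₂) ℂ)
    (W : Matrix (Fin t₂) (TxIndex t₁ t₂) ℂ) : ℝ :=
  Real.log ((h.cognitiveOutputCov T₁ T₂).det.re / (h.dpcJointCov T₁ T₂ W).det.re)

end ChannelState

section Scheme

variable {t₁ t₂ r₁ r₂ : ℕ}

/-- `Σ'`, the covariance matrix of `[X₁; X₂]`, where `[X₁; X₂₁]` has covariance `T₁ T₁*`, where
`X₂ = X₂₁ + X₂₂`, and where `X₂₂` is independent of `[X₁; X₂₁]` with covariance `T₂ T₂*`. -/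
def inputCov (T₁ : Matrix (TxIndex t₁ t₂) (TxIndex t₁ t₂) ℂ) (T₂ : Matrix (Fin t₂) (Fin t₂) ℂ) :
    Matrix (TxIndex t₁ t₂) (TxIndex t₁ t₂) ℂ :=
  T₁ * T₁ᴴ + fromBlocks 0 0 0 (T₂ * T₂ᴴ)

/-- The power constraints `tr Σ₁ ≤ Pp` and `tr (Σ₂₁ + Σ₂₂) ≤ Pc`. -/
def PowerFeasible (Pp Pc : ℝ) (T₁ : Matrix (TxIndex t₁ t₂) (TxIndex t₁ t₂) ℂ)
    (T₂ : Matrix (Fin t₂) (Fin t₂) ℂ) : Prop :=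
  (T₁ * T₁ᴴ).toBlocks₁₁.trace.re ≤ Pp ∧
    ((T₁ * T₁ᴴ).toBlocks₂₂ + T₂ * T₂ᴴ).trace.re ≤ Pc

/-- The inflation factor `W = [0 T₂⁺]`. -/
def pinvInflation (t₁ : ℕ) (T₂ : Matrix (Fin t₂) (Fin t₂) ℂ) :
    Matrix (Fin t₂) (TxIndex t₁ t₂) ℂ :=
  fromCols 0 (pinv T₂)

variable {Ω : Type*} [MeasurableSpace Ω]

/-- `R_p`: the expectation of the primary rate over the fading. -/
def Rp (μ : Measure Ω) (H : Ω → ChannelState t₁ t₂ r₁ r₂)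
    (T₁ : Matrix (TxIndex t₁ t₂) (TxIndex t₁ t₂) ℂ) (T₂ : Matrix (Fin t₂) (Fin t₂) ℂ) : ℝ :=
  ∫ ω, (H ω).primaryRate T₁ T₂ ∂μ

/-- `R_c`: the expectation of the cognitive rate over the fading. -/
def Rc (μ : Measure Ω) (H : Ω → ChannelState t₁ t₂ r₁ r₂)
    (T₁ : Matrix (TxIndex t₁ t₂) (TxIndex t₁ t₂) ℂ) (T₂ : Matrix (Fin t₂) (Fin t₂) ℂ)
    (W : Matrix (Fin t₂) (TxIndex t₁ t₂) ℂ) : ℝ :=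
  ∫ ω, (H ω).cognitiveRate T₁ T₂ W ∂μ

/-- All sum-rates `R_sum = R_p + R_c` that the scheme achieves without channel knowledge at the
transmitters (`T₁`, `T₂`, `W` do not depend on the realization) under the power constraints. -/
def sumRates (μ : Measure Ω) (H : Ω → ChannelState t₁ t₂ r₁ r₂) (Pp Pc : ℝ) : Set ℝ :=
  {R | ∃ (T₁ : Matrix (TxIndex t₁ t₂) (TxIndex t₁ t₂) ℂ) (T₂ : Matrix (Fin t₂) (Fin t₂) ℂ)
      (W : Matrix (Fin t₂) (TxIndex t₁ t₂) ℂ),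
      PowerFeasible Pp Pc T₁ T₂ ∧ R = Rp μ H T₁ T₂ + Rc μ H T₁ T₂ W}

end Scheme

/-- `γ_p = min (r₁, rank Σ') - min (r₁, rank Σ₂₂)`, with `s = rank Σ'` and `k = rank Σ₂₂`. -/
def gammaP (r₁ s k : ℕ) : ℝ := (min r₁ s : ℕ) - (min r₁ k : ℕ)

/-- `γ_c = min (r₂, rank Σ') - min (r₂, rank Σ' - rank Σ₂₂)`, with `s = rank Σ'` and
`k = rank Σ₂₂ ≤ s`. -/
def gammaC (r₂ s k : ℕ) : ℝ := (min r₂ s : ℕ) - (min r₂ (s - k) : ℕ)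

/-- The rank pairs `(rank Σ', rank Σ₂₂)` over which the sum is maximized. -/
def AdmissibleRanks (t₁ t₂ s k : ℕ) : Prop := 0 < s ∧ s ≤ t₁ + t₂ ∧ k ≤ min t₂ s

/-- A random matrix with finite logarithmic moment: all entries are random variables, and
`log (1 + ‖A‖²)` is integrable, where `‖A‖` is the Frobenius norm. -/
structure IsLogIntegrable {Ω : Type*} [MeasurableSpace Ω] (μ : Measure Ω) {m n : ℕ}
    (A : Ω → Matrix (Fin m) (Fin n) ℂ) : Prop where
  measurable : ∀ a b, Measurable fun ω => A ω a b
  integrable : Integrable (fun ω => Real.log (1 + ∑ a, ∑ b, ‖A ω a b‖ ^ 2)) μ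

/-- The σ-algebra generated by the entries of a random matrix. -/
@[reducible] def entrySigma {Ω : Type*} {m n : ℕ} (A : Ω → Matrix (Fin m) (Fin n) ℂ) : MeasurableSpace Ω :=
  ⨆ a, ⨆ b, MeasurableSpace.comap (fun ω => A ω a b) inferInstance

/-- A random matrix `G` with `m` rows is generic if, for every positive semidefinite `A`,
`rank (G A G*) = min (m, rank A)` with probability one. -/
def IsGenericFading {Ω : Type*} [MeasurableSpace Ω] (μ : Measure Ω) {m : ℕ} {ι : Type*}
    [Fintype ι] (G : Ω → Matrix (Fin m) ι ℂ) : Prop :=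
  ∀ A : Matrix ι ι ℂ, A.PosSemidef → ∀ᵐ ω ∂μ, (G ω * A * (G ω)ᴴ).rank = min m A.rank

/-- The standing assumptions on the fading: finite logarithmic moments (so that all rates are
finite), full-rank and mutually independent channel matrices, and genericity of the joint channels
to the two receivers. -/
structure IsFadingCRC {Ω : Type*} [MeasurableSpace Ω] (μ : Measure Ω) {t₁ t₂ r₁ r₂ : ℕ}
    (H : Ω → ChannelState t₁ t₂ r₁ r₂) : Prop where
  log₁₁ : IsLogIntegrable μ fun ω => (H ω).H₁₁
  log₁₂ : IsLogIntegrable μ fun ω => (H ω).H₁₂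
  log₂₁ : IsLogIntegrable μ fun ω => (H ω).H₂₁
  log₂₂ : IsLogIntegrable μ fun ω => (H ω).H₂₂
  rank₁₁ : ∀ᵐ ω ∂μ, (H ω).H₁₁.rank = min r₁ t₁
  rank₁₂ : ∀ᵐ ω ∂μ, (H ω).H₁₂.rank = min r₂ t₁
  rank₂₁ : ∀ᵐ ω ∂μ, (H ω).H₂₁.rank = min r₁ t₂
  rank₂₂ : ∀ᵐ ω ∂μ, (H ω).H₂₂.rank = min r₂ t₂
  indep : iIndep ![entrySigma fun ω => (H ω).H₁₁, entrySigma fun ω => (H ω).H₁₂,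
    entrySigma fun ω => (H ω).H₂₁, entrySigma fun ω => (H ω).H₂₂] μ
  generic₁ : IsGenericFading μ fun ω => (H ω).Hbar₁
  generic₂ : IsGenericFading μ fun ω => (H ω).Hbar₂

end

/-! Everything is expressed through `logDet A = log det (1 + A)`. The primary rate is the `logDet`
of the full input seen by receiver 1 minus that of the private signal seen there (`primaryRate_eq`).
In the cognitive rate, a Schur complement splits the joint determinant into the determinant of the
covariance of `U`, which does not involve the channel, and a `logDet` of the error covariance of the
input given `U` (`cognitiveRate_eq`).

Achievability. For generic fading, dominated convergence gives `E logDet (G (P A) Gᴴ) / log P → min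
(r, rank A)` (`tendsto_integral_logDet`). Scaling the inputs by `√P` scales `W = [0 T₂⁺]` by its
inverse, so the covariance of `U` is unchanged and the error covariance is multiplied by `P`. With
this `W`, `U` is a linear image of the total input plus the part `(1 - T₂⁺ T₂) X₂₂'`, which is
uncorrelated with that input. Comparing two block factorizations of the same joint covariance then
gives the error rank `rank Σ' - rank Σ₂₂` (`rank_errorCov_add`, `rank_errorCov_pinvInflation`).

Converse. Whatever `W` is, the cognitive rate is at most the rate with the interference known at the
receiver (`det_output_le`, `cognitiveRate_le`). Hence the sum-rate is at most the full rate at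
receiver 1 plus the difference of the private signal's `logDet` through `H₂₂` and through `H₂₁`. The
covariance may vary arbitrarily with the power, so this difference has to be bounded uniformly
(`integral_logDet_sub_le`). With ordered eigenvalues `d i`, each expected `logDet` is compared with
the sum of the leading `log (1 + d i)`. The upper estimate is deterministic up to a log moment; the
lower one loses a factor `1 - δ` and a constant, because compactness of the set of isometries makes
genericity uniform (`exists_uniform_gramRatio`). Both directions meet at `max (min r₁ (t₁ + t₂))
(min r₂ t₂)`, the value of the rank maximization (`isGreatest_gamma`). -/

set_option linter.unusedSectionVars false

/-! ### Determinant and trace inequalities for positive semidefinite matrices. -/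

section MatrixAnalysis

variable {n m : Type*} [Fintype n] [DecidableEq n] [Fintype m] [DecidableEq m]

/-- Spectral decomposition of a positive semidefinite complex matrix. -/
theorem posSemidef_spectral {A : Matrix n n ℂ} (hA : A.PosSemidef) :
    ∃ (V : Matrix n n ℂ) (d : n → ℝ), Vᴴ * V = 1 ∧ V * Vᴴ = 1 ∧ (∀ i, 0 ≤ d i) ∧
      A = V * diagonal (fun i => (d i : ℂ)) * Vᴴ ∧ A.trace.re = ∑ i, d i ∧
      A.rank = Fintype.card {i // d i ≠ 0} := by
  refine ⟨hA.1.eigenvectorUnitary, hA.1.eigenvalues, ?_, ?_, hA.eigenvalues_nonneg, ?_, ?_,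
    hA.1.rank_eq_card_non_zero_eigs⟩
  · simpa [star_eq_conjTranspose] using Unitary.coe_star_mul_self hA.1.eigenvectorUnitary
  · simpa [star_eq_conjTranspose] using Unitary.coe_mul_star_self hA.1.eigenvectorUnitary
  · have := hA.1.spectral_theorem
    rw [Unitary.conjStarAlgAut_apply] at this
    simpa [star_eq_conjTranspose, Function.comp_def] using this
  · rw [hA.1.trace_eq_sum_eigenvalues]
    simp

theorem det_unitary_conj {V D : Matrix n n ℂ} (hV : V * Vᴴ = 1) :
    (V * D * Vᴴ).det = D.det := by
  have h : V.det * Vᴴ.det = 1 := by rw [← det_mul, hV, det_one]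
  rw [det_mul, det_mul]
  linear_combination D.det * h

theorem one_add_smul_unitary_conj {V : Matrix n n ℂ} (hV : V * Vᴴ = 1) (d : n → ℝ) (c : ℝ) :
    1 + (c : ℂ) • (V * diagonal (fun i => (d i : ℂ)) * Vᴴ) =
      V * diagonal (fun i => ((1 + c * d i : ℝ) : ℂ)) * Vᴴ := by
  have : diagonal (fun i => ((1 + c * d i : ℝ) : ℂ)) =
      1 + (c : ℂ) • diagonal (fun i => (d i : ℂ)) := by
    rw [← diagonal_one, ← diagonal_smul, diagonal_add]
    congr 1; funext i; simp
  rw [this, Matrix.mul_add, Matrix.add_mul, Matrix.mul_one, hV, Matrix.mul_smul, Matrix.smul_mul]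

theorem det_one_add_smul_of_spectral {V : Matrix n n ℂ} (hV : V * Vᴴ = 1) (d : n → ℝ) (c : ℝ) :
    (1 + (c : ℂ) • (V * diagonal (fun i => (d i : ℂ)) * Vᴴ)).det.re = ∏ i, (1 + c * d i) := by
  rw [one_add_smul_unitary_conj hV, det_unitary_conj hV, det_diagonal, ← Complex.ofReal_prod,
    Complex.ofReal_re]

theorem det_re_nonneg {A : Matrix n n ℂ} (hA : A.PosSemidef) : 0 ≤ A.det.re :=
  (Complex.nonneg_iff.1 hA.det_nonneg).1

theorem det_im_eq_zero {A : Matrix n n ℂ} (hA : A.PosSemidef) : A.det.im = 0 :=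
  (Complex.nonneg_iff.1 hA.det_nonneg).2.symm

theorem det_ofReal_re {A : Matrix n n ℂ} (hA : A.PosSemidef) : (A.det.re : ℂ) = A.det :=
  Complex.ext rfl (by simp [det_im_eq_zero hA])

theorem posSemidef_one_add {A : Matrix n n ℂ} (hA : A.PosSemidef) : (1 + A).PosSemidef :=
  PosSemidef.one.add hA

theorem posDef_one_add {A : Matrix n n ℂ} (hA : A.PosSemidef) : (1 + A).PosDef :=
  PosDef.one.add_posSemidef hA

theorem one_le_det_one_add {A : Matrix n n ℂ} (hA : A.PosSemidef) : 1 ≤ (1 + A).det.re := by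
  obtain ⟨V, d, -, hV, hd, hAV, -, -⟩ := posSemidef_spectral hA
  have := det_one_add_smul_of_spectral hV d 1
  rw [Complex.ofReal_one, one_smul, ← hAV] at this
  rw [this]
  exact Finset.one_le_prod (fun i => by simpa using hd i)

theorem exists_eq_mul_conjTranspose {A : Matrix n n ℂ} (hA : A.PosSemidef) :
    ∃ S : Matrix n n ℂ, A = S * Sᴴ := by
  obtain ⟨V, d, -, hV, hd, hAV, -, -⟩ := posSemidef_spectral hA
  refine ⟨V * diagonal (fun i => ((√(d i) : ℝ) : ℂ)), ?_⟩
  rw [conjTranspose_mul, diagonal_conjTranspose, Matrix.mul_assoc, ← Matrix.mul_assoc (diagonal _),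
    diagonal_mul_diagonal, ← Matrix.mul_assoc]
  have h : (fun i => ((√(d i) : ℝ) : ℂ) * star (fun i => ((√(d i) : ℝ) : ℂ)) i) =
      fun i => (d i : ℂ) := by
    funext i
    simp [← Complex.ofReal_mul, Real.mul_self_sqrt (hd i)]
  rw [h, hAV]

/-- The determinant is monotone on positive semidefinite matrices. -/
theorem det_re_le_det_add {A B : Matrix n n ℂ} (hA : A.PosSemidef) (hB : B.PosSemidef) :
    A.det.re ≤ (A + B).det.re := by
  -- A singular `A` leaves only nonnegativity to check. Otherwise `A = S Sᴴ` with `S` invertible,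
  -- and `S` factors out of `A + B`.
  by_cases h0 : A.det = 0
  · rw [h0]; exact det_re_nonneg (hA.add hB)
  obtain ⟨S, rfl⟩ := exists_eq_mul_conjTranspose hA
  have hS : IsUnit S.det := by
    rw [isUnit_iff_ne_zero]
    rintro h
    rw [det_mul, h, zero_mul] at h0
    exact h0 rfl
  have hS' : IsUnit Sᴴ.det := by
    rw [det_conjTranspose]; exact hS.star
  have hB' : (S⁻¹ * B * (S⁻¹)ᴴ).PosSemidef := hB.mul_mul_conjTranspose_same _
  have h1 : S * Sᴴ + B = S * (1 + S⁻¹ * B * (S⁻¹)ᴴ) * Sᴴ := by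
    rw [Matrix.mul_add, Matrix.add_mul, Matrix.mul_one, conjTranspose_nonsing_inv]
    congr 1
    simp only [← Matrix.mul_assoc]
    rw [mul_nonsing_inv _ hS, Matrix.one_mul, Matrix.mul_assoc, nonsing_inv_mul _ hS',
      Matrix.mul_one]
  have h2 : (S * Sᴴ + B).det = (S * Sᴴ).det * (1 + S⁻¹ * B * (S⁻¹)ᴴ).det := by
    rw [h1, det_mul, det_mul, det_mul]; ring
  rw [h2, Complex.mul_re, det_im_eq_zero hA, zero_mul, sub_zero]
  exact le_mul_of_one_le_right (det_re_nonneg hA) (one_le_det_one_add hB')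

theorem det_re_le_of_sub {A B : Matrix n n ℂ} (hA : A.PosSemidef) (hAB : (B - A).PosSemidef) :
    A.det.re ≤ B.det.re := by
  simpa using det_re_le_det_add hA hAB

theorem det_one_add_le_pow {A : Matrix n n ℂ} (hA : A.PosSemidef) :
    (1 + A).det.re ≤ (1 + A.trace.re) ^ Fintype.card n := by
  obtain ⟨V, d, -, hV, hd, hAV, htr, -⟩ := posSemidef_spectral hA
  have := det_one_add_smul_of_spectral hV d 1
  rw [Complex.ofReal_one, one_smul, ← hAV] at this
  rw [this, ← Finset.card_univ, htr]
  rw [← Finset.prod_const]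
  refine Finset.prod_le_prod (fun i _ => by have := hd i; positivity) fun i _ => ?_
  rw [one_mul]
  gcongr
  exact Finset.single_le_sum (fun i _ => hd i) (Finset.mem_univ i)

theorem trace_re_nonneg {A : Matrix n n ℂ} (hA : A.PosSemidef) : 0 ≤ A.trace.re :=
  (Complex.nonneg_iff.1 hA.trace_nonneg).1

/-- A positive semidefinite matrix is dominated by its trace times the identity. -/
theorem posSemidef_smul_one_sub {A : Matrix n n ℂ} (hA : A.PosSemidef) {c : ℝ}
    (hc : A.trace.re ≤ c) : ((c : ℂ) • (1 : Matrix n n ℂ) - A).PosSemidef := by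
  obtain ⟨V, d, -, hV, hd, hAV, htr, -⟩ := posSemidef_spectral hA
  have : (c : ℂ) • (1 : Matrix n n ℂ) - A =
      V * diagonal (fun i => ((c - d i : ℝ) : ℂ)) * Vᴴ := by
    have h : diagonal (fun i => ((c - d i : ℝ) : ℂ)) =
        (c : ℂ) • (1 : Matrix n n ℂ) - diagonal (fun i => (d i : ℂ)) := by
      rw [← diagonal_one, ← diagonal_smul, diagonal_sub]
      congr 1; funext i; simp
    rw [h, Matrix.mul_sub, Matrix.sub_mul, Matrix.mul_smul, Matrix.smul_mul, Matrix.mul_one, hV,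
      ← hAV]
  rw [this]
  refine PosSemidef.mul_mul_conjTranspose_same (PosSemidef.diagonal fun i => ?_) _
  have : d i ≤ c := (Finset.single_le_sum (fun i _ => hd i) (Finset.mem_univ i)).trans
    (htr ▸ hc)
  simpa using this

theorem posSemidef_real_smul {A : Matrix n n ℂ} (hA : A.PosSemidef) {c : ℝ} (hc : 0 ≤ c) :
    ((c : ℂ) • A).PosSemidef :=
  hA.smul (by simpa using hc)

/-- `log det (1 + A)`. -/
noncomputable def logDet (A : Matrix n n ℂ) : ℝ := Real.log (1 + A).det.re

theorem logDet_nonneg {A : Matrix n n ℂ} (hA : A.PosSemidef) : 0 ≤ logDet A :=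
  Real.log_nonneg (one_le_det_one_add hA)

theorem logDet_mul_comm (X : Matrix m n ℂ) (Y : Matrix n m ℂ) :
    logDet (X * Y) = logDet (Y * X) := by
  rw [logDet, logDet, det_one_add_mul_comm]

theorem logDet_le {A : Matrix n n ℂ} (hA : A.PosSemidef) :
    logDet A ≤ Fintype.card n * Real.log (1 + A.trace.re) := by
  rw [← Real.log_pow]
  exact Real.log_le_log (zero_lt_one.trans_le (one_le_det_one_add hA)) (det_one_add_le_pow hA)

/-- Sylvester's identity allows the smaller of the two Gram matrices to be used, whence the minimum
of the dimensions. -/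
theorem logDet_mul_conjTranspose_le (X : Matrix m n ℂ) :
    logDet (X * Xᴴ) ≤
      (min (Fintype.card m) (Fintype.card n) : ℕ) * Real.log (1 + (X * Xᴴ).trace.re) := by
  rcases le_total (Fintype.card m) (Fintype.card n) with h | h
  · rw [min_eq_left h]
    exact logDet_le (posSemidef_self_mul_conjTranspose X)
  · rw [min_eq_right h, logDet_mul_comm, trace_mul_comm]
    exact logDet_le (posSemidef_conjTranspose_mul_self X)

/-- The squared Frobenius norm. -/
noncomputable def frobSq {m n : Type*} [Fintype m] [Fintype n] (G : Matrix m n ℂ) : ℝ := ∑ a, ∑ b, ‖G a b‖ ^ 2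

theorem frobSq_nonneg (G : Matrix m n ℂ) : 0 ≤ frobSq G := by unfold frobSq; positivity

theorem trace_self_mul_conjTranspose_re (G : Matrix m n ℂ) : (G * Gᴴ).trace.re = frobSq G := by
  simp only [trace, diag_apply, mul_apply, conjTranspose_apply, Complex.re_sum, frobSq]
  refine Finset.sum_congr rfl fun a _ => Finset.sum_congr rfl fun b _ => ?_
  rw [Complex.star_def, Complex.mul_conj, Complex.ofReal_re, Complex.normSq_eq_norm_sq]

theorem trace_conj_le {A : Matrix n n ℂ} (hA : A.PosSemidef) (G : Matrix m n ℂ) :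
    (G * A * Gᴴ).trace.re ≤ A.trace.re * frobSq G := by
  have h := trace_re_nonneg
    ((posSemidef_smul_one_sub hA le_rfl).mul_mul_conjTranspose_same G)
  rw [Matrix.mul_sub, Matrix.sub_mul, Matrix.mul_smul, Matrix.smul_mul, Matrix.mul_one, trace_sub,
    trace_smul, Complex.sub_re, smul_eq_mul, Complex.re_ofReal_mul,
    trace_self_mul_conjTranspose_re] at h
  linarith

/-- Separates the power `c` from the channel gain. It serves both as the integrable majorant and as
the bound on the rate at the primary receiver. -/
theorem logDet_conj_le {A : Matrix n n ℂ} (hA : A.PosSemidef) (G : Matrix m n ℂ) {c : ℝ}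
    (hc : A.trace.re ≤ c) :
    logDet (G * A * Gᴴ) ≤ (min (Fintype.card m) (Fintype.card n) : ℕ) *
      (Real.log (1 + c) + Real.log (1 + frobSq G)) := by
  obtain ⟨S, hS⟩ := exists_eq_mul_conjTranspose hA
  have h1 : G * A * Gᴴ = (G * S) * (G * S)ᴴ := by
    rw [hS, conjTranspose_mul]; simp only [Matrix.mul_assoc]
  have h2 := logDet_mul_conjTranspose_le (G * S)
  rw [← h1] at h2
  refine h2.trans ?_
  have h3 := trace_conj_le hA G
  have h4 := trace_re_nonneg (hA.mul_mul_conjTranspose_same G)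
  have h5 := trace_re_nonneg hA
  have h6 := frobSq_nonneg G
  rw [← Real.log_mul (by linarith) (by linarith)]
  gcongr
  nlinarith [mul_le_mul_of_nonneg_right hc h6]

end MatrixAnalysis

/-! ### Deterministic bounds by leading eigenvalues. -/

section OrderedSpectrum

/-- Spectral decomposition with eigenvalues in decreasing order. -/
theorem posSemidef_spectral_antitone {t : ℕ} {A : Matrix (Fin t) (Fin t) ℂ} (hA : A.PosSemidef) :
    ∃ (V : Matrix (Fin t) (Fin t) ℂ) (d : Fin t → ℝ), Vᴴ * V = 1 ∧ (∀ i, 0 ≤ d i) ∧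
      Antitone d ∧ A = V * diagonal (fun i => (d i : ℂ)) * Vᴴ ∧ ∀ i, d i ≤ A.trace.re := by
  obtain ⟨V, d, hV, -, hd, hAV, htr, -⟩ := posSemidef_spectral hA
  let σ := Tuple.sort fun i => -d i
  refine ⟨V.submatrix id σ, d ∘ σ, ?_, fun i => hd _, fun i j hij => ?_, ?_, fun i => ?_⟩
  · rw [conjTranspose_submatrix, ← submatrix_mul _ _ _ id _ Function.bijective_id, hV,
      submatrix_one_equiv]
  · have := Tuple.monotone_sort (fun i => -d i) hij
    simpa using this
  · have : diagonal (fun i => (((d ∘ σ) i : ℝ) : ℂ)) =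
        (diagonal fun i => (d i : ℂ)).submatrix σ σ := by
      rw [submatrix_diagonal_equiv]; rfl
    rw [this, conjTranspose_submatrix, submatrix_mul_equiv, submatrix_mul_equiv, ← hAV,
      submatrix_id_id]
  · rw [htr]
    exact Finset.single_le_sum (fun i _ => hd i) (Finset.mem_univ (σ i))

variable {r t : ℕ}

/-- The columns of `V` indexed by the first `m` indices. -/
def leadingCols {n : Type*} {m : ℕ} (h : m ≤ t) (V : Matrix n (Fin t) ℂ) : Matrix n (Fin m) ℂ :=
  V.submatrix id (Fin.castLE h)

theorem leadingCols_isometry {n : Type*} [Fintype n] {m : ℕ} (h : m ≤ t)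
    {V : Matrix n (Fin t) ℂ} (hV : Vᴴ * V = 1) :
    (leadingCols h V)ᴴ * leadingCols h V = 1 := by
  have : (leadingCols h V)ᴴ * leadingCols h V =
      (Vᴴ * V).submatrix (Fin.castLE h) (Fin.castLE h) := by
    rw [leadingCols, conjTranspose_submatrix, submatrix_mul _ _ _ id _ Function.bijective_id]
  rw [this, hV, submatrix_one _ (Fin.castLE_injective h)]

theorem leadingCols_mul_diagonal {n : Type*} {m : ℕ} (h : m ≤ t)
    (V : Matrix n (Fin t) ℂ) (d : Fin t → ℂ) :
    leadingCols h V * diagonal (d ∘ Fin.castLE h) * (leadingCols h V)ᴴ =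
      V * diagonal (fun i => if i.1 < m then d i else 0) * Vᴴ := by
  ext a b
  rw [mul_apply, mul_apply]
  simp only [leadingCols, mul_diagonal, submatrix_apply, id, conjTranspose_apply,
    Function.comp]
  obtain ⟨k, rfl⟩ := Nat.exists_eq_add_of_le h
  rw [Fin.sum_univ_add]
  have : ∀ i : Fin m, Fin.castLE h i = Fin.castAdd k i := fun i => rfl
  simp [this]

theorem leadingCols_mul {l n : Type*} [Fintype n] {m : ℕ} (h : m ≤ t) (G : Matrix l n ℂ)
    (V : Matrix n (Fin t) ℂ) : G * leadingCols h V = leadingCols h (G * V) := by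
  ext a b
  simp [leadingCols, mul_apply]

/-- The determinant in a Gram-matrix lower bound, normalized by the trace. -/
noncomputable def gramRatio {r : Type*} [Fintype r] {m : ℕ} (X : Matrix r (Fin m) ℂ) : ℝ :=
  (Xᴴ * X).det.re / (1 + (Xᴴ * X).trace.re) ^ m

/-- Isolates the dependence on `X` in a factor free of `d`, so that a lower bound on `gramRatio`
works for all powers at once. -/
theorem gramRatio_mul_prod_le {r : Type*} [Fintype r] [DecidableEq r] {m : ℕ}
    (X : Matrix r (Fin m) ℂ) (d : Fin m → ℝ) (hd : ∀ i, 0 ≤ d i) :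
    gramRatio X * ∏ i, (1 + d i) ≤
      (1 + X * diagonal (fun i => (d i : ℂ)) * Xᴴ).det.re := by
  have hN := posSemidef_conjTranspose_mul_self X
  obtain ⟨S, hS⟩ := exists_eq_mul_conjTranspose hN
  set τ : ℝ := 1 + (Xᴴ * X).trace.re with hτ
  have hτ1 : 1 ≤ τ := by have := trace_re_nonneg hN; linarith
  have hτ0 : (τ : ℂ) ≠ 0 := by exact_mod_cast (zero_lt_one.trans_le hτ1).ne'
  set D : Matrix (Fin m) (Fin m) ℂ := diagonal (fun i => (d i : ℂ)) with hD
  have hDp : D.PosSemidef := PosSemidef.diagonal fun i => by simpa using hd i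
  have hdet1 : (1 + X * D * Xᴴ).det = (1 + Sᴴ * D * S).det := by
    rw [Matrix.mul_assoc, det_one_add_mul_comm, Matrix.mul_assoc, Matrix.mul_assoc Sᴴ,
      det_one_add_mul_comm Sᴴ, Matrix.mul_assoc, hS]
  have hSS : (Sᴴ * S).trace.re ≤ τ := by
    rw [trace_mul_comm, ← hS]; linarith
  -- Both `Sᴴ S ≤ τ` and `1 ≤ τ` enter: the first handles the identity, the second the term with
  -- `D`.
  have hle : ((1 + Sᴴ * D * S) - ((τ⁻¹ : ℝ) : ℂ) • (Sᴴ * (1 + D) * S)).PosSemidef := by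
    have h1 := posSemidef_smul_one_sub (posSemidef_conjTranspose_mul_self S) hSS
    have h2 := posSemidef_real_smul h1 (c := τ⁻¹) (by positivity)
    have h3 := posSemidef_real_smul (hDp.conjTranspose_mul_mul_same S) (c := 1 - τ⁻¹)
      (sub_nonneg.2 (inv_le_one_of_one_le₀ hτ1))
    convert h2.add h3 using 1
    rw [smul_sub, smul_smul, Matrix.mul_add, Matrix.add_mul, smul_add, Matrix.mul_one]
    push_cast
    rw [inv_mul_cancel₀ hτ0, one_smul, sub_smul, one_smul]
    abel
  have hp : (((τ⁻¹ : ℝ) : ℂ) • (Sᴴ * (1 + D) * S)).PosSemidef :=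
    posSemidef_real_smul ((posSemidef_one_add hDp).conjTranspose_mul_mul_same S)
      (by positivity)
  have h := det_re_le_of_sub hp hle
  rw [hdet1]
  refine le_of_eq_of_le ?_ h
  have h1D : (1 + D).det = ((∏ i, (1 + d i) : ℝ) : ℂ) := by
    rw [hD, ← diagonal_one, diagonal_add, det_diagonal]; push_cast; rfl
  have hdet2 : (Sᴴ * (1 + D) * S).det = (Xᴴ * X).det * ((∏ i, (1 + d i) : ℝ) : ℂ) := by
    rw [det_mul, det_mul, hS, det_mul, h1D]; ring
  rw [det_smul, hdet2, Fintype.card_fin, gramRatio, ← hτ, ← det_ofReal_re hN]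
  norm_cast
  rw [inv_pow]; field_simp

/-- Discarding the diagonal entries from index `m` on only decreases the determinant; the rest is a
Gram bound for the leading columns. -/
theorem det_one_add_conj_diagonal_lower {l : Type*} [Fintype l] [DecidableEq l] {m : ℕ}
    (h : m ≤ t) (G : Matrix l (Fin t) ℂ) (V : Matrix (Fin t) (Fin t) ℂ) (d : Fin t → ℝ)
    (hd : ∀ i, 0 ≤ d i) :
    gramRatio (G * leadingCols h V) * ∏ i : Fin m, (1 + d (Fin.castLE h i)) ≤
      (1 + G * (V * diagonal (fun i => (d i : ℂ)) * Vᴴ) * Gᴴ).det.re := by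
  refine (gramRatio_mul_prod_le _ _ fun i => hd _).trans ?_
  have e : G * leadingCols h V * diagonal (fun i => (d (Fin.castLE h i) : ℂ)) *
      (G * leadingCols h V)ᴴ =
      (G * V) * diagonal (fun i : Fin t => if i.1 < m then (d i : ℂ) else 0) * (G * V)ᴴ := by
    rw [leadingCols_mul, ← leadingCols_mul_diagonal h]; rfl
  have hp : (diagonal (fun i : Fin t => if i.1 < m then (d i : ℂ) else 0)).PosSemidef :=
    PosSemidef.diagonal fun i => by
      have := hd i
      by_cases h : i.1 < m <;> simp [h, this]
  have hp' : (diagonal (fun i : Fin t => if i.1 < m then 0 else (d i : ℂ))).PosSemidef :=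
    PosSemidef.diagonal fun i => by
      have := hd i
      by_cases h : i.1 < m <;> simp [h, this]
  rw [e]
  have e2 : 1 + G * (V * diagonal (fun i => (d i : ℂ)) * Vᴴ) * Gᴴ =
      1 + (G * V) * diagonal (fun i : Fin t => if i.1 < m then (d i : ℂ) else 0) * (G * V)ᴴ +
      (G * V) * diagonal (fun i : Fin t => if i.1 < m then 0 else (d i : ℂ)) * (G * V)ᴴ := by
    rw [add_assoc, ← Matrix.add_mul, ← Matrix.mul_add, diagonal_add, conjTranspose_mul]
    simp only [Matrix.mul_assoc]
    congr 6
    funext i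
    by_cases h : i.1 < m <;> simp [h]
  rw [e2]
  exact det_re_le_det_add (posSemidef_one_add (hp.mul_mul_conjTranspose_same _))
    (hp'.mul_mul_conjTranspose_same _)

theorem det_one_add_conj_diagonal_le_all {l : Type*} [Fintype l] [DecidableEq l]
    (X : Matrix l (Fin t) ℂ) (d : Fin t → ℝ) (hd : ∀ i, 0 ≤ d i) {g : ℝ} (hg : frobSq X ≤ g) :
    (1 + X * diagonal (fun i => (d i : ℂ)) * Xᴴ).det.re ≤ ∏ i, (1 + g * d i) := by
  have hg0 : 0 ≤ g := (frobSq_nonneg X).trans hg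
  set R : Matrix (Fin t) (Fin t) ℂ := diagonal (fun i => ((√(d i) : ℝ) : ℂ)) with hR
  have hRh : Rᴴ = R := by
    rw [hR, diagonal_conjTranspose]; congr 1; funext i; simp
  have hRR : R * R = diagonal (fun i => (d i : ℂ)) := by
    rw [hR, diagonal_mul_diagonal]; congr 1; funext i
    rw [← Complex.ofReal_mul, Real.mul_self_sqrt (hd i)]
  have e : (1 + X * diagonal (fun i => (d i : ℂ)) * Xᴴ).det = (1 + Rᴴ * (Xᴴ * X) * R).det := by
    rw [← hRR, ← Matrix.mul_assoc, Matrix.mul_assoc, det_one_add_mul_comm, hRh]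
    simp only [Matrix.mul_assoc]
  have hs : ((Xᴴ * X).trace).re ≤ g := by
    rw [trace_mul_comm, trace_self_mul_conjTranspose_re]; exact hg
  have hsub := posSemidef_smul_one_sub (posSemidef_conjTranspose_mul_self X) hs
  have h := det_re_le_of_sub
    (posSemidef_one_add ((posSemidef_conjTranspose_mul_self X).conjTranspose_mul_mul_same R))
    (B := 1 + Rᴴ * ((g : ℂ) • 1) * R) (by
      rw [add_sub_add_left_eq_sub, ← Matrix.sub_mul, ← Matrix.mul_sub]
      exact hsub.conjTranspose_mul_mul_same R)
  rw [e]
  refine h.trans_eq ?_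
  rw [hRh, Matrix.mul_smul, Matrix.mul_one, Matrix.smul_mul, hRR, ← diagonal_one, ← diagonal_smul,
    diagonal_add, det_diagonal]
  have : ∀ i, (1 + ((g : ℂ) • fun i => (d i : ℂ)) i) = ((1 + g * d i : ℝ) : ℂ) := by
    intro i; simp
  simp only [this]
  rw [← Complex.ofReal_prod, Complex.ofReal_re]

/-- An `r`-row channel resolves at most `r` eigenvalues, and the largest ones give the worst case.
This is what makes the upper and lower estimates involve the same leading eigenvalues. -/
theorem det_one_add_conj_diagonal_le (X : Matrix (Fin r) (Fin t) ℂ) (d : Fin t → ℝ)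
    (hd : ∀ i, 0 ≤ d i) (hanti : Antitone d) :
    (1 + X * diagonal (fun i => (d i : ℂ)) * Xᴴ).det.re ≤
      ∏ i : Fin (min r t), (1 + frobSq X * d (Fin.castLE (min_le_right r t) i)) := by
  have hg0 := frobSq_nonneg X
  rcases le_or_gt t r with h | h
  · refine (det_one_add_conj_diagonal_le_all X d hd le_rfl).trans_eq ?_
    exact (Fintype.prod_equiv (finCongr (min_eq_right h)) _ _ fun i => rfl).symm
  rcases Nat.eq_zero_or_pos r with rfl | hr
  · have : IsEmpty (Fin (min 0 t)) := by rw [Nat.zero_min]; infer_instance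
    simp
  -- The threshold is the `r`-th largest eigenvalue. Since `D ≤ c + (D - c)⁺`, the eigenvalues below
  -- it are absorbed into the noise level `1 + c g`, and `(D - c)⁺` lives on the first `r` indices.
  -- The factor `(1 + c g) ^ r` then recombines exactly into `∏ (1 + g d i)`.
  set c : ℝ := d ⟨r - 1, by omega⟩ with hc
  have hc0 : 0 ≤ c := hd _
  set g := frobSq X
  set e : Fin t → ℝ := fun i => max (d i - c) 0 with he
  have hpos : 0 < 1 + c * g := by positivity
  have hpc : ((1 + c * g : ℝ) : ℂ) ≠ 0 := by exact_mod_cast hpos.ne'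
  have hep : (diagonal (fun i => (e i : ℂ))).PosSemidef :=
    PosSemidef.diagonal fun i => by simp [he]
  have hsub : (((1 + c * g : ℝ) : ℂ) • (1 : Matrix (Fin r) (Fin r) ℂ) +
      X * diagonal (fun i => (e i : ℂ)) * Xᴴ -
      (1 + X * diagonal (fun i => (d i : ℂ)) * Xᴴ)).PosSemidef := by
    have h1 := posSemidef_real_smul (posSemidef_smul_one_sub
      (posSemidef_self_mul_conjTranspose X) (trace_self_mul_conjTranspose_re X).le) hc0
    have h2 : (diagonal (fun i => ((e i + c - d i : ℝ) : ℂ))).PosSemidef :=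
      PosSemidef.diagonal fun i => by
        have : d i ≤ e i + c := by have := le_max_left (d i - c) 0; simp only [he]; linarith
        have : 0 ≤ e i + c - d i := by linarith
        change (0 : ℂ) ≤ _
        exact_mod_cast this
    convert h1.add (h2.mul_mul_conjTranspose_same X) using 1
    have h3 : diagonal (fun i => ((e i + c - d i : ℝ) : ℂ)) = diagonal (fun i => (e i : ℂ)) +
        (c : ℂ) • (1 : Matrix (Fin t) (Fin t) ℂ) - diagonal (fun i => (d i : ℂ)) := by
      rw [← diagonal_one, ← diagonal_smul, diagonal_add, diagonal_sub]
      congr 1; funext i; simp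
    rw [h3, Matrix.mul_sub, Matrix.mul_add, Matrix.sub_mul, Matrix.add_mul, Matrix.mul_smul,
      Matrix.mul_one, Matrix.smul_mul, smul_sub, smul_smul]
    push_cast
    rw [add_smul, one_smul]
    abel
  have hdp : (diagonal (fun i => (d i : ℂ))).PosSemidef :=
    PosSemidef.diagonal fun i => by simpa using hd i
  refine (det_re_le_of_sub (posSemidef_one_add (hdp.mul_mul_conjTranspose_same X)) hsub).trans ?_
  have e1 : ((1 + c * g : ℝ) : ℂ) • (1 : Matrix (Fin r) (Fin r) ℂ) +
      X * diagonal (fun i => (e i : ℂ)) * Xᴴ = ((1 + c * g : ℝ) : ℂ) •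
      (1 + X * diagonal (fun i => ((e i / (1 + c * g) : ℝ) : ℂ)) * Xᴴ) := by
    have : diagonal (fun i => (e i : ℂ)) =
        ((1 + c * g : ℝ) : ℂ) • diagonal (fun i => ((e i / (1 + c * g) : ℝ) : ℂ)) := by
      rw [← diagonal_smul]; congr 1; funext i
      simp only [Pi.smul_apply, smul_eq_mul]
      rw [Complex.ofReal_div, mul_div_cancel₀ _ hpc]
    rw [this, Matrix.mul_smul, Matrix.smul_mul, ← smul_add]
  rw [e1, det_smul, ← Complex.ofReal_pow, Complex.re_ofReal_mul, Fintype.card_fin]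
  have h4 := det_one_add_conj_diagonal_le_all X (fun i => e i / (1 + c * g))
    (fun i => div_nonneg (le_max_right _ _) hpos.le) le_rfl
  refine (mul_le_mul_of_nonneg_left h4 (by positivity)).trans_eq ?_
  have hmin : min r t = r := min_eq_left h.le
  have e2 : ∏ i : Fin (min r t), (1 + g * d (Fin.castLE (min_le_right r t) i)) =
      ∏ i : Fin r, (1 + g * d (Fin.castLE h.le i)) :=
    Fintype.prod_equiv (finCongr hmin) _ _ fun i => rfl
  rw [e2]
  obtain ⟨k, rfl⟩ := Nat.exists_eq_add_of_le h.le
  rw [Fin.prod_univ_add]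
  have h5 : ∏ i : Fin k, (1 + g * (e (Fin.natAdd r i) / (1 + c * g))) = 1 := by
    refine Finset.prod_eq_one fun i _ => ?_
    have : d (Fin.natAdd r i) ≤ c := hanti (by rw [Fin.le_def]; simp; omega)
    have : e (Fin.natAdd r i) = 0 := max_eq_right (by linarith)
    rw [this]; simp
  change _ * ((∏ i : Fin r, (1 + g * (e (Fin.castAdd k i) / (1 + c * g)))) *
    ∏ i : Fin k, (1 + g * (e (Fin.natAdd r i) / (1 + c * g)))) = _
  rw [h5, mul_one]
  have h6 : (1 + c * g) ^ r = ∏ _i : Fin r, (1 + c * g) := by simp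
  rw [h6, ← Finset.prod_mul_distrib]
  refine Finset.prod_congr rfl fun i _ => ?_
  have : c ≤ d (Fin.castAdd k i) := hanti (by rw [Fin.le_def]; simp; omega)
  have : e (Fin.castAdd k i) = d (Fin.castAdd k i) - c := max_eq_left (by linarith)
  rw [this]
  change _ = 1 + g * d (Fin.castAdd k i)
  field_simp
  ring

end OrderedSpectrum

/-! ### Expected log-determinants over a random channel. -/

section RandomMatrix

variable {Ω : Type*} [MeasurableSpace Ω] {μ : Measure Ω}
variable {l n m : Type*} [Fintype n] [DecidableEq n] [Fintype m] [DecidableEq m] [Fintype l]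
  [DecidableEq l]

/-- All entries of a random matrix are random variables. -/
def MeasurableEntries (G : Ω → Matrix m n ℂ) : Prop := ∀ a b, Measurable fun ω => G ω a b

namespace MeasurableEntries

theorem const (A : Matrix m n ℂ) : MeasurableEntries fun _ : Ω => A := fun _ _ => measurable_const

theorem mul {G : Ω → Matrix l m ℂ} {K : Ω → Matrix m n ℂ} (hG : MeasurableEntries G)
    (hK : MeasurableEntries K) : MeasurableEntries fun ω => G ω * K ω := by
  intro a b
  simp only [mul_apply]
  exact Finset.measurable_sum _ fun i _ => (hG a i).mul (hK i b)

theorem add {G K : Ω → Matrix m n ℂ} (hG : MeasurableEntries G) (hK : MeasurableEntries K) :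
    MeasurableEntries fun ω => G ω + K ω := fun a b => (hG a b).add (hK a b)

theorem conjTranspose {G : Ω → Matrix m n ℂ} (hG : MeasurableEntries G) :
    MeasurableEntries fun ω => (G ω)ᴴ := fun a b => Complex.continuous_conj.measurable.comp (hG b a)

theorem det {G : Ω → Matrix n n ℂ} (hG : MeasurableEntries G) :
    Measurable fun ω => (G ω).det := by
  simp only [det_apply]
  refine Finset.measurable_sum _ fun σ _ => Measurable.const_smul ?_ _
  exact Finset.measurable_prod _ fun i _ => hG _ _

theorem conj {G : Ω → Matrix m n ℂ} (hG : MeasurableEntries G) (A : Matrix n n ℂ) :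
    MeasurableEntries fun ω => G ω * A * (G ω)ᴴ := (hG.mul (const A)).mul hG.conjTranspose

theorem logDet {G : Ω → Matrix n n ℂ} (hG : MeasurableEntries G) :
    Measurable fun ω => logDet (G ω) :=
  Real.measurable_log.comp (Complex.measurable_re.comp ((const 1).add hG).det)

theorem gramRatio {k : ℕ} {G : Ω → Matrix m (Fin k) ℂ} (hG : MeasurableEntries G) :
    Measurable fun ω => gramRatio (G ω) := by
  have h := hG.conjTranspose.mul hG
  refine (Complex.measurable_re.comp h.det).div
    ((measurable_const.add (Complex.measurable_re.comp ?_)).pow_const k)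
  exact Finset.measurable_sum _ fun i _ => h i i

end MeasurableEntries

/-- A random matrix with measurable entries and finite logarithmic moment. -/
structure HasLogMoment (μ : Measure Ω) (G : Ω → Matrix m n ℂ) : Prop where
  entries : MeasurableEntries G
  integrable : Integrable (fun ω => Real.log (1 + frobSq (G ω))) μ

variable [IsProbabilityMeasure μ]

theorem HasLogMoment.integrable_logDet {G : Ω → Matrix m n ℂ} (hG : HasLogMoment μ G)
    {A : Matrix n n ℂ} (hA : A.PosSemidef) :
    Integrable (fun ω => logDet (G ω * A * (G ω)ᴴ)) μ := by
  refine Integrable.mono' (g := fun ω => ((min (Fintype.card m) (Fintype.card n) : ℕ) : ℝ) *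
      (Real.log (1 + A.trace.re) + Real.log (1 + frobSq (G ω))))
    (((integrable_const _).add hG.integrable).const_mul _)
    (hG.entries.conj A).logDet.aestronglyMeasurable (Eventually.of_forall fun ω => ?_)
  rw [Real.norm_of_nonneg (logDet_nonneg (hA.mul_mul_conjTranspose_same _))]
  exact logDet_conj_le hA _ le_rfl

theorem HasLogMoment.integral_logDet_le {G : Ω → Matrix m n ℂ} (hG : HasLogMoment μ G)
    {A : Matrix n n ℂ} (hA : A.PosSemidef) {c : ℝ} (hc : A.trace.re ≤ c) :
    ∫ ω, logDet (G ω * A * (G ω)ᴴ) ∂μ ≤ (min (Fintype.card m) (Fintype.card n) : ℕ) *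
      (Real.log (1 + c) + ∫ ω, Real.log (1 + frobSq (G ω)) ∂μ) := by
  have h := integral_mono (hG.integrable_logDet hA)
    (((integrable_const (Real.log (1 + c))).add hG.integrable).const_mul
      ((min (Fintype.card m) (Fintype.card n) : ℕ) : ℝ)) fun ω => logDet_conj_le hA (G ω) hc
  refine h.trans_eq ?_
  simp only [Pi.add_apply]
  rw [integral_const_mul, integral_add (integrable_const _) hG.integrable]
  simp

theorem tendsto_log_one_add_mul_div_log {x : ℝ} (hx : 0 ≤ x) :
    Tendsto (fun P : ℝ => Real.log (1 + P * x) / Real.log P) atTop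
      (𝓝 (if x ≠ 0 then 1 else 0)) := by
  split_ifs with h
  · have hx' : 0 < x := lt_of_le_of_ne hx (Ne.symm h)
    have h1 : Tendsto (fun P : ℝ => 1 + Real.log (P⁻¹ + x) / Real.log P) atTop (𝓝 (1 + 0)) := by
      refine tendsto_const_nhds.add (Tendsto.div_atTop (a := Real.log (0 + x)) ?_
        Real.tendsto_log_atTop)
      exact ((tendsto_inv_atTop_zero).add tendsto_const_nhds).log (by simpa using h)
    rw [add_zero] at h1
    refine h1.congr' ?_
    filter_upwards [eventually_gt_atTop 1] with P hP
    have hP0 : 0 < P := by linarith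
    have hl : Real.log P ≠ 0 := (Real.log_pos hP).ne'
    have : 1 + P * x = P * (P⁻¹ + x) := by field_simp
    rw [this, Real.log_mul hP0.ne' (by positivity)]
    field_simp
  · simp [not_not.1 h]

/-- Each nonzero eigenvalue contributes one `log P`. Besides giving pointwise limits, this turns
determinant identities into rank identities. -/
theorem tendsto_logDet_div_log {A : Matrix n n ℂ} (hA : A.PosSemidef) :
    Tendsto (fun P : ℝ => logDet ((P : ℂ) • A) / Real.log P) atTop (𝓝 A.rank) := by
  obtain ⟨V, d, -, hV, hd, hAV, -, hr⟩ := posSemidef_spectral hA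
  have h1 : Tendsto (fun P : ℝ => ∑ i, Real.log (1 + P * d i) / Real.log P) atTop
      (𝓝 (∑ i, if d i ≠ 0 then 1 else 0)) :=
    tendsto_finsetSum _ fun i _ => tendsto_log_one_add_mul_div_log (hd i)
  have h2 : (∑ i, if d i ≠ 0 then (1 : ℝ) else 0) = A.rank := by
    rw [hr, Fintype.card_subtype, Finset.sum_boole]
  rw [h2] at h1
  refine h1.congr' ?_
  filter_upwards [eventually_ge_atTop 0] with P hP
  rw [logDet, hAV, det_one_add_smul_of_spectral hV, Real.log_prod, Finset.sum_div]
  intro i _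
  have := hd i
  positivity

theorem tendsto_integral_logDet {r : ℕ} {G : Ω → Matrix (Fin r) n ℂ} (hG : HasLogMoment μ G)
    (hgen : IsGenericFading μ G) {A : Matrix n n ℂ} (hA : A.PosSemidef) :
    Tendsto (fun P : ℝ => (∫ ω, logDet (G ω * ((P : ℂ) • A) * (G ω)ᴴ) ∂μ) / Real.log P) atTop
      (𝓝 (min r A.rank : ℕ)) := by
  have htr := trace_re_nonneg hA
  have h : Tendsto (fun P : ℝ => ∫ ω, logDet (G ω * ((P : ℂ) • A) * (G ω)ᴴ) / Real.log P ∂μ) atTop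
      (𝓝 (∫ _ω, ((min r A.rank : ℕ) : ℝ) ∂μ)) := by
    refine tendsto_integral_filter_of_dominated_convergence
      (fun ω => ((min (Fintype.card (Fin r)) (Fintype.card n) : ℕ) : ℝ) *
        (2 + Real.log (1 + A.trace.re) + Real.log (1 + frobSq (G ω))))
      (Eventually.of_forall fun P => ?_) ?_ ?_ ?_
    · exact ((hG.entries.conj _).logDet.div_const _).aestronglyMeasurable
    -- Beyond `e` one has `log P ≥ 1`, so the terms that do not grow with `P` stay bounded after the
    -- division.
    · filter_upwards [eventually_ge_atTop (Real.exp 1)] with P hP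
      refine Eventually.of_forall fun ω => ?_
      have hP1 : 1 ≤ P := by
        have := Real.add_one_le_exp (1 : ℝ); linarith
      have hP0 : 0 ≤ P := by linarith
      have hl : 1 ≤ Real.log P := by rwa [Real.le_log_iff_exp_le (by linarith)]
      have hAP := posSemidef_real_smul hA hP0
      rw [Real.norm_of_nonneg (div_nonneg (logDet_nonneg (hAP.mul_mul_conjTranspose_same _))
        (by linarith)), div_le_iff₀ (by linarith)]
      have h1 := logDet_conj_le hAP (G ω) (c := P * A.trace.re) (by
        rw [trace_smul, smul_eq_mul, Complex.re_ofReal_mul])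
      refine h1.trans ?_
      rw [mul_assoc]
      refine mul_le_mul_of_nonneg_left ?_ (by positivity)
      have h2 : Real.log (1 + P * A.trace.re) ≤ Real.log P + Real.log (1 + A.trace.re) := by
        rw [← Real.log_mul (by linarith) (by linarith)]
        refine Real.log_le_log (by positivity) ?_
        nlinarith
      have h3 : 0 ≤ Real.log (1 + A.trace.re) := Real.log_nonneg (by linarith)
      have h4 : 0 ≤ Real.log (1 + frobSq (G ω)) :=
        Real.log_nonneg (by linarith [frobSq_nonneg (G ω)])
      nlinarith
    · exact ((integrable_const _).add hG.integrable).const_mul _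
    · filter_upwards [hgen A hA] with ω hω
      have := tendsto_logDet_div_log (hA.mul_mul_conjTranspose_same (G ω))
      rw [hω] at this
      simpa only [Matrix.mul_smul, Matrix.smul_mul] using this
  simp only [integral_const, probReal_univ, smul_eq_mul, one_mul, integral_div] at h
  exact h

theorem gramRatio_pos_of_rank {r k : ℕ} {X : Matrix (Fin r) (Fin k) ℂ} (hX : X.rank = k) :
    0 < gramRatio X := by
  have hN := posSemidef_conjTranspose_mul_self X
  have htr := trace_re_nonneg hN
  have hr : (Xᴴ * X).rank = k := by rw [rank_conjTranspose_mul_self, hX]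
  refine div_pos ?_ (by positivity)
  refine lt_of_le_of_ne (det_re_nonneg hN) fun h => ?_
  have hdet : (Xᴴ * X).det = 0 := by rw [← det_ofReal_re hN, ← h]; simp
  obtain ⟨v, hv, hv0⟩ := exists_mulVec_eq_zero_iff.2 hdet
  have h1 := LinearMap.finrank_range_add_finrank_ker (Xᴴ * X).mulVecLin
  have h2 : Module.finrank ℂ (LinearMap.range (Xᴴ * X).mulVecLin) = k := hr
  rw [h2, Module.finrank_fin_fun] at h1
  have h3 : LinearMap.ker (Xᴴ * X).mulVecLin = ⊥ := by
    rw [← Submodule.finrank_eq_zero (R := ℂ)]; omega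
  exact hv (LinearMap.ker_eq_bot'.1 h3 v hv0)

theorem continuous_gramRatio {l : Type*} [Fintype l] {k : ℕ} :
    Continuous (gramRatio : Matrix l (Fin k) ℂ → ℝ) := by
  unfold gramRatio
  have h : Continuous fun X : Matrix l (Fin k) ℂ => Xᴴ * X :=
    continuous_id.matrix_conjTranspose.matrix_mul continuous_id
  refine (Complex.continuous_re.comp h.matrix_det).div
    ((continuous_const.add (Complex.continuous_re.comp h.matrix_trace)).pow k) fun X => ?_
  have := trace_re_nonneg (posSemidef_conjTranspose_mul_self X)
  positivity

theorem isCompact_isometries {t k : ℕ} :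
    IsCompact {V : Matrix (Fin t) (Fin k) ℂ | Vᴴ * V = 1} := by
  have hK : IsCompact (Set.univ.pi fun _ : Fin t => Set.univ.pi fun _ : Fin k =>
      Metric.closedBall (0 : ℂ) 1) :=
    isCompact_univ_pi fun _ => isCompact_univ_pi fun _ => isCompact_closedBall _ _
  have hcl : IsClosed {V : Matrix (Fin t) (Fin k) ℂ | Vᴴ * V = 1} :=
    isClosed_eq (continuous_id.matrix_conjTranspose.matrix_mul continuous_id) continuous_const
  refine hK.of_isClosed_subset hcl fun (V : Matrix (Fin t) (Fin k) ℂ) hV i _ j _ =>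
    mem_closedBall_zero_iff.2 ?_
  have h : ((V : Matrix (Fin t) (Fin k) ℂ)ᴴ * (V : Matrix (Fin t) (Fin k) ℂ)) j j =
      (1 : Matrix (Fin k) (Fin k) ℂ) j j := congr_fun (congr_fun hV j) j
  rw [Matrix.mul_apply, one_apply_eq] at h
  have h2 : ∑ a, ‖V a j‖ ^ 2 = 1 := by
    have := congr_arg Complex.re h
    simp only [Complex.re_sum, conjTranspose_apply, Complex.one_re] at this
    rw [← this]
    refine Finset.sum_congr rfl fun a _ => ?_
    rw [mul_comm, Complex.star_def, Complex.mul_conj, Complex.ofReal_re, Complex.normSq_eq_norm_sq]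
  have h3 : ‖V i j‖ ^ 2 ≤ 1 :=
    h2 ▸ Finset.single_le_sum (f := fun a => ‖V a j‖ ^ 2) (fun a _ => by positivity)
      (Finset.mem_univ i)
  exact (sq_le_one_iff₀ (norm_nonneg _)).1 h3

/-- Genericity is uniform over isometries: the normalized Gram determinant of `G V` is bounded
below outside an event of small probability that is uniform in `V`. -/
theorem exists_uniform_gramRatio {r t k : ℕ} (hk : k ≤ r) {G : Ω → Matrix (Fin r) (Fin t) ℂ}
    (hG : MeasurableEntries G) (hgen : IsGenericFading μ G) {δ : ℝ} (hδ : 0 < δ) :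
    ∃ η : ℝ, 0 < η ∧ ∀ V : Matrix (Fin t) (Fin k) ℂ, Vᴴ * V = 1 →
      μ.real {ω | gramRatio (G ω * V) < η} ≤ δ := by
  by_contra! hcon
  -- Were there no uniform `η`, isometries failing at the thresholds `1 / (j + 1)` would accumulate
  -- at an isometry `W`. Genericity for `W Wᴴ`, of rank `k ≤ r`, makes the limiting ratio almost
  -- surely positive, so the bad events have probability tending to zero.
  choose V hV hVδ using fun j : ℕ => hcon (1 / ((j : ℝ) + 1)) (by positivity)
  have : FirstCountableTopology (Matrix (Fin t) (Fin k) ℂ) :=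
    inferInstanceAs (FirstCountableTopology (Fin t → Fin k → ℂ))
  obtain ⟨W, hW, φ, hφ, hlim⟩ := isCompact_isometries.tendsto_subseq hV
  have hWr : (W * Wᴴ).rank = k := by
    rw [rank_self_mul_conjTranspose, ← rank_conjTranspose_mul_self, hW.out, rank_one,
      Fintype.card_fin]
  have hae : ∀ᵐ ω ∂μ, 0 < gramRatio (G ω * W) := by
    filter_upwards [hgen _ (posSemidef_self_mul_conjTranspose W)] with ω hω
    refine gramRatio_pos_of_rank ?_
    rw [hWr, min_eq_right hk, ← Matrix.mul_assoc, Matrix.mul_assoc, ← conjTranspose_mul,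
      rank_self_mul_conjTranspose] at hω
    exact hω
  have hmeas : ∀ j, MeasurableSet {ω | gramRatio (G ω * V (φ j)) < 1 / ((φ j : ℝ) + 1)} :=
    fun j => measurableSet_lt (hG.mul (MeasurableEntries.const _)).gramRatio measurable_const
  have htend : Tendsto (fun j => ∫ ω, Set.indicator
      {ω | gramRatio (G ω * V (φ j)) < 1 / ((φ j : ℝ) + 1)} (fun _ => (1 : ℝ)) ω ∂μ) atTop
      (𝓝 (∫ _ω, (0 : ℝ) ∂μ)) := by
    refine tendsto_integral_of_dominated_convergence (fun _ => 1)
      (fun j => (measurable_const.indicator (hmeas j)).aestronglyMeasurable)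
      (integrable_const _) (fun j => Eventually.of_forall fun ω => ?_) ?_
    · by_cases h : ω ∈ {ω | gramRatio (G ω * V (φ j)) < 1 / ((φ j : ℝ) + 1)}
      · rw [Set.indicator_of_mem h]; simp
      · rw [Set.indicator_of_notMem h]; simp
    · filter_upwards [hae] with ω hω
      have h1 : Tendsto (fun j => gramRatio (G ω * V (φ j))) atTop (𝓝 (gramRatio (G ω * W))) :=
        ((continuous_gramRatio.comp
          (continuous_const.matrix_mul continuous_id)).tendsto W).comp hlim
      have h2 : Tendsto (fun j => 1 / ((φ j : ℝ) + 1)) atTop (𝓝 0) :=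
        tendsto_one_div_add_atTop_nhds_zero_nat.comp hφ.tendsto_atTop
      refine tendsto_const_nhds.congr' ?_
      filter_upwards [h2.eventually_lt h1 hω] with j hj
      rw [Set.indicator_of_notMem]
      simpa using hj.le
  simp only [integral_indicator_const _ (hmeas _), smul_eq_mul, mul_one, integral_zero] at htend
  have := ge_of_tendsto' htend fun j => (hVδ (φ j)).le
  linarith

/-- The constant depends on `δ` and the channel law but not on the covariance, which is free to
change with the power. -/
theorem sum_log_le_integral_logDet {r t : ℕ} {G : Ω → Matrix (Fin r) (Fin t) ℂ}
    (hG : HasLogMoment μ G) (hgen : IsGenericFading μ G) {δ : ℝ} (hδ : 0 < δ) :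
    ∃ C : ℝ, 0 ≤ C ∧ ∀ (V : Matrix (Fin t) (Fin t) ℂ) (d : Fin t → ℝ), Vᴴ * V = 1 →
      (∀ i, 0 ≤ d i) →
      (1 - δ) * (∑ i : Fin (min r t), Real.log (1 + d (Fin.castLE (min_le_right r t) i))) - C ≤
        ∫ ω, logDet (G ω * (V * diagonal (fun i => (d i : ℂ)) * Vᴴ) * (G ω)ᴴ) ∂μ := by
  obtain ⟨η, hη, hu⟩ := exists_uniform_gramRatio (min_le_left r t) hG.entries hgen hδ
  refine ⟨|Real.log η|, abs_nonneg _, fun V d hV hd => ?_⟩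
  set S := ∑ i : Fin (min r t), Real.log (1 + d (Fin.castLE (min_le_right r t) i)) with hS
  have hS0 : 0 ≤ S := Finset.sum_nonneg fun i _ =>
    Real.log_nonneg (by linarith [hd (Fin.castLE (min_le_right r t) i)])
  have hA : (V * diagonal (fun i => (d i : ℂ)) * Vᴴ).PosSemidef :=
    (PosSemidef.diagonal fun i => by simpa using hd i).mul_mul_conjTranspose_same V
  set X := leadingCols (min_le_right r t) V
  set E := {ω | gramRatio (G ω * X) < η} with hE
  have hEm : MeasurableSet E :=
    measurableSet_lt (hG.entries.mul (MeasurableEntries.const _)).gramRatio measurable_const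
  have hEδ : μ.real E ≤ δ := hu _ (leadingCols_isometry _ hV)
  -- On the bad event only `logDet ≥ 0` is used; this costs the factor `1 - δ`. Elsewhere the Gram
  -- ratio is at least `η`.
  have hlow : ∀ ω, Eᶜ.indicator (fun _ => S) ω - |Real.log η| ≤
      logDet (G ω * (V * diagonal (fun i => (d i : ℂ)) * Vᴴ) * (G ω)ᴴ) := by
    intro ω
    have h0 := logDet_nonneg (hA.mul_mul_conjTranspose_same (G ω))
    by_cases h : ω ∈ E
    · rw [Set.indicator_of_notMem (by simpa using h)]
      linarith [abs_nonneg (Real.log η)]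
    · rw [Set.indicator_of_mem (by simpa using h)]
      have hη' : η ≤ gramRatio (G ω * X) := not_lt.1 h
      have h1 := det_one_add_conj_diagonal_lower (min_le_right r t) (G ω) V d hd
      have hpp : ∀ i : Fin (min r t), 0 < 1 + d (Fin.castLE (min_le_right r t) i) := fun i => by
        linarith [hd (Fin.castLE (min_le_right r t) i)]
      have hprod : 0 < ∏ i : Fin (min r t), (1 + d (Fin.castLE (min_le_right r t) i)) :=
        Finset.prod_pos fun i _ => hpp i
      have h2 := Real.log_le_log (mul_pos (hη.trans_le hη') hprod) h1
      rw [Real.log_mul (hη.trans_le hη').ne' hprod.ne',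
        Real.log_prod (fun i _ => (hpp i).ne')] at h2
      have h3 := Real.log_le_log hη hη'
      have h4 := neg_abs_le (Real.log η)
      rw [logDet]
      linarith
  have hint := integral_mono (((integrable_const S).indicator hEm.compl).sub
    (integrable_const |Real.log η|)) (hG.integrable_logDet hA) hlow
  simp only [Pi.sub_apply] at hint
  rw [integral_sub ((integrable_const S).indicator hEm.compl) (integrable_const _),
    integral_indicator_const _ hEm.compl, integral_const, probReal_compl_eq_one_sub hEm] at hint
  simp only [probReal_univ, smul_eq_mul, one_mul] at hint
  refine le_trans ?_ hint
  gcongr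

/-- The gain separates from the spectrum by `1 + g d ≤ (1 + g) (1 + d)`; genericity plays no role in
this direction. -/
theorem integral_logDet_le_sum_log {r t : ℕ} {G : Ω → Matrix (Fin r) (Fin t) ℂ}
    (hG : HasLogMoment μ G) {V : Matrix (Fin t) (Fin t) ℂ} {d : Fin t → ℝ}
    (hV : Vᴴ * V = 1) (hd : ∀ i, 0 ≤ d i) (hanti : Antitone d) :
    ∫ ω, logDet (G ω * (V * diagonal (fun i => (d i : ℂ)) * Vᴴ) * (G ω)ᴴ) ∂μ ≤
      (∑ i : Fin (min r t), Real.log (1 + d (Fin.castLE (min_le_right r t) i))) +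
        (min r t : ℕ) * ∫ ω, Real.log (1 + frobSq (G ω)) ∂μ := by
  set S := ∑ i : Fin (min r t), Real.log (1 + d (Fin.castLE (min_le_right r t) i)) with hS
  have hA : (V * diagonal (fun i => (d i : ℂ)) * Vᴴ).PosSemidef :=
    (PosSemidef.diagonal fun i => by simpa using hd i).mul_mul_conjTranspose_same V
  have hV' : V * Vᴴ = 1 := mul_eq_one_comm.1 hV
  have hup : ∀ ω, logDet (G ω * (V * diagonal (fun i => (d i : ℂ)) * Vᴴ) * (G ω)ᴴ) ≤
      S + (min r t : ℕ) * Real.log (1 + frobSq (G ω)) := by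
    intro ω
    have hf : frobSq (G ω * V) = frobSq (G ω) := by
      rw [← trace_self_mul_conjTranspose_re, ← trace_self_mul_conjTranspose_re, conjTranspose_mul,
        Matrix.mul_assoc, ← Matrix.mul_assoc V, hV', Matrix.one_mul]
    have h1 := det_one_add_conj_diagonal_le (G ω * V) d hd hanti
    have e : G ω * (V * diagonal (fun i => (d i : ℂ)) * Vᴴ) * (G ω)ᴴ =
        (G ω * V) * diagonal (fun i => (d i : ℂ)) * (G ω * V)ᴴ := by
      rw [conjTranspose_mul]; simp only [Matrix.mul_assoc]
    have hg := frobSq_nonneg (G ω)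
    rw [hf, ← e] at h1
    have hpos := zero_lt_one.trans_le (one_le_det_one_add (hA.mul_mul_conjTranspose_same (G ω)))
    refine (Real.log_le_log hpos h1).trans ?_
    rw [Real.log_prod (fun i _ => by
      have := hd (Fin.castLE (min_le_right r t) i); positivity)]
    have : ((min r t : ℕ) : ℝ) * Real.log (1 + frobSq (G ω)) =
        ∑ _i : Fin (min r t), Real.log (1 + frobSq (G ω)) := by simp
    rw [this, hS, ← Finset.sum_add_distrib]
    refine Finset.sum_le_sum fun i _ => ?_
    have := hd (Fin.castLE (min_le_right r t) i)
    rw [← Real.log_mul (by positivity) (by positivity)]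
    exact Real.log_le_log (by positivity) (by nlinarith)
  have h := integral_mono (hG.integrable_logDet hA)
    ((integrable_const S).add (hG.integrable.const_mul _)) hup
  refine h.trans_eq ?_
  simp only [Pi.add_apply]
  rw [integral_add (integrable_const _) (hG.integrable.const_mul _), integral_const_mul]
  simp

/-- Truncated subtraction is intended: for `a ≤ b` the difference is nonpositive, otherwise exactly
`a - b` terms survive. -/
theorem sum_castLE_sub_le {t a b : ℕ} (ha : a ≤ t) (hb : b ≤ t) {f : Fin t → ℝ} {c : ℝ}
    (h0 : ∀ i, 0 ≤ f i) (hc : ∀ i, f i ≤ c) :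
    ∑ i : Fin a, f (Fin.castLE ha i) - ∑ i : Fin b, f (Fin.castLE hb i) ≤ (a - b : ℕ) * c := by
  rcases le_total a b with h | h
  · obtain ⟨k, rfl⟩ := Nat.exists_eq_add_of_le h
    rw [Fin.sum_univ_add, Nat.sub_eq_zero_of_le h]
    have : 0 ≤ ∑ i : Fin k, f (Fin.castLE hb (Fin.natAdd a i)) :=
      Finset.sum_nonneg fun i _ => h0 _
    have e : ∑ i : Fin a, f (Fin.castLE hb (Fin.castAdd k i)) = ∑ i : Fin a, f (Fin.castLE ha i) :=
      rfl
    rw [e]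
    simp only [Nat.cast_zero, zero_mul]
    linarith
  · obtain ⟨k, rfl⟩ := Nat.exists_eq_add_of_le h
    rw [Fin.sum_univ_add, Nat.add_sub_cancel_left]
    have h1 : ∑ i : Fin k, f (Fin.castLE ha (Fin.natAdd b i)) ≤ ∑ _i : Fin k, c :=
      Finset.sum_le_sum fun i _ => hc _
    rw [Finset.sum_const, Finset.card_univ, Fintype.card_fin, nsmul_eq_mul] at h1
    have e : ∑ i : Fin b, f (Fin.castLE ha (Fin.castAdd k i)) = ∑ i : Fin b, f (Fin.castLE hb i) :=
      rfl
    rw [e]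
    linarith

/-- The mutual information over one random matrix exceeds that over a generic one by at most the
difference of the dimensions, on the logarithmic scale and uniformly in the covariance. -/
theorem integral_logDet_sub_le {r₁ r₂ t : ℕ} {G₁ : Ω → Matrix (Fin r₁) (Fin t) ℂ}
    {G₂ : Ω → Matrix (Fin r₂) (Fin t) ℂ} (hG₁ : HasLogMoment μ G₁) (hgen : IsGenericFading μ G₁)
    (hG₂ : HasLogMoment μ G₂) {δ : ℝ} (hδ : 0 < δ) :
    ∃ C : ℝ, ∀ (A : Matrix (Fin t) (Fin t) ℂ) (c : ℝ), A.PosSemidef → A.trace.re ≤ c →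
      ∫ ω, logDet (G₂ ω * A * (G₂ ω)ᴴ) ∂μ - ∫ ω, logDet (G₁ ω * A * (G₁ ω)ᴴ) ∂μ ≤
        ((min r₂ t - min r₁ t : ℕ) + δ * t) * Real.log (1 + c) + C := by
  obtain ⟨C, hC, h⟩ := sum_log_le_integral_logDet hG₁ hgen hδ
  refine ⟨C + (min r₂ t : ℕ) * ∫ ω, Real.log (1 + frobSq (G₂ ω)) ∂μ, fun A c hA hc => ?_⟩
  obtain ⟨V, d, hV, hd, hanti, rfl, hdc⟩ := posSemidef_spectral_antitone hA
  have h1 := h V d hV hd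
  have h2 := integral_logDet_le_sum_log hG₂ hV hd hanti
  have hf0 : ∀ i, 0 ≤ Real.log (1 + d i) := fun i => Real.log_nonneg (by linarith [hd i])
  have hfc : ∀ i, Real.log (1 + d i) ≤ Real.log (1 + c) := fun i =>
    Real.log_le_log (by linarith [hd i]) (by linarith [hdc i])
  have h3 := sum_castLE_sub_le (min_le_right r₂ t) (min_le_right r₁ t) hf0 hfc
  -- The case `b = 0` bounds the whole leading sum, which controls the loss from the factor `1 - δ`.
  have h5 := sum_castLE_sub_le (min_le_right r₁ t) (Nat.zero_le t) hf0 hfc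
  simp only [Finset.univ_eq_empty, Finset.sum_empty, sub_zero, Nat.sub_zero] at h5
  have hc0 : 0 ≤ Real.log (1 + c) :=
    Real.log_nonneg (by linarith [trace_re_nonneg hA])
  have h6 : ((min r₁ t : ℕ) : ℝ) * Real.log (1 + c) ≤ t * Real.log (1 + c) := by
    gcongr
    exact min_le_right _ _
  have h7 := mul_le_mul_of_nonneg_left (h5.trans h6) hδ.le
  linarith

end RandomMatrix

/-! ### Rank identities from the growth of log-determinants. -/

section RankLemmas

variable {n m k l : Type*} [Fintype n] [DecidableEq n] [Fintype m] [DecidableEq m]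
  [Fintype k] [DecidableEq k] [Fintype l] [DecidableEq l]

/-- Multiplicativity of the determinant over the blocks makes the `logDet` growth rates add, and
these rates are the ranks. -/
theorem rank_fromBlocks_diagonal {A : Matrix n n ℂ} {D : Matrix m m ℂ} (hA : A.PosSemidef)
    (hD : D.PosSemidef) : (fromBlocks A 0 0 D).rank = A.rank + D.rank := by
  have hp : (fromBlocks A 0 0 D).PosSemidef := by
    obtain ⟨S, rfl⟩ := exists_eq_mul_conjTranspose hA
    obtain ⟨R, rfl⟩ := exists_eq_mul_conjTranspose hD
    have : fromBlocks (S * Sᴴ) 0 0 (R * Rᴴ) = fromBlocks S 0 0 R * (fromBlocks S 0 0 R)ᴴ := by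
      rw [fromBlocks_conjTranspose, fromBlocks_multiply]; simp
    rw [this]
    exact posSemidef_self_mul_conjTranspose _
  have h := (tendsto_logDet_div_log hA).add (tendsto_logDet_div_log hD)
  have h' := tendsto_nhds_unique (h.congr' ?_) (tendsto_logDet_div_log hp)
  · exact_mod_cast h'.symm
  · filter_upwards [eventually_ge_atTop 0] with P hP
    have hA' := posSemidef_one_add (posSemidef_real_smul hA hP)
    have hA1 := one_le_det_one_add (posSemidef_real_smul hA hP)
    have hD1 := one_le_det_one_add (posSemidef_real_smul hD hP)
    rw [← add_div]
    congr 1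
    rw [logDet, logDet, logDet, ← Real.log_mul (by linarith) (by linarith), ← fromBlocks_one,
      fromBlocks_smul, fromBlocks_add, smul_zero, smul_zero, add_zero, add_zero,
      det_fromBlocks_zero₂₁, Complex.mul_re, det_im_eq_zero hA', zero_mul, sub_zero]

/-- Since `(1 - Q) Q = 0`, `(1 + P (1 - Q)) (1 + P Q) = 1 + P`; comparing growth rates gives the
ranks. -/
theorem rank_add_rank_one_sub {Q : Matrix n n ℂ} (hQ : Q.IsHermitian) (hQ2 : Q * Q = Q) :
    Q.PosSemidef ∧ (1 - Q).PosSemidef ∧ (1 - Q).rank + Q.rank = Fintype.card n := by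
  have hp : Q.PosSemidef := by
    have := posSemidef_self_mul_conjTranspose Q
    rwa [hQ.eq, hQ2] at this
  have hR : (1 - Q) * (1 - Q) = 1 - Q := by
    rw [Matrix.sub_mul, Matrix.one_mul, Matrix.mul_sub, Matrix.mul_one, hQ2]; abel
  have hp' : (1 - Q).PosSemidef := by
    have := posSemidef_self_mul_conjTranspose (1 - Q)
    rwa [conjTranspose_sub, conjTranspose_one, hQ.eq, hR] at this
  refine ⟨hp, hp', ?_⟩
  have h := (tendsto_logDet_div_log hp').add (tendsto_logDet_div_log hp)
  have h' := tendsto_nhds_unique (h.congr' ?_)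
    (tendsto_logDet_div_log (PosSemidef.one (n := n) (R := ℂ)))
  · rw [rank_one] at h'
    exact_mod_cast h'
  · filter_upwards [eventually_ge_atTop 0] with P hP
    have hA' := posSemidef_one_add (posSemidef_real_smul hp' hP)
    have hA1 := one_le_det_one_add (posSemidef_real_smul hp' hP)
    have hD1 := one_le_det_one_add (posSemidef_real_smul hp hP)
    have h0 : (1 - Q) * Q = 0 := by rw [Matrix.sub_mul, Matrix.one_mul, hQ2, sub_self]
    have e : (1 + (P : ℂ) • (1 - Q)) * (1 + (P : ℂ) • Q) = 1 + (P : ℂ) • 1 := by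
      rw [Matrix.mul_add, Matrix.mul_one, Matrix.mul_smul, Matrix.add_mul, Matrix.smul_mul, h0,
        smul_zero, add_zero, Matrix.one_mul, smul_sub]
      abel
    rw [← add_div]
    congr 1
    rw [logDet, logDet, logDet, ← Real.log_mul (by linarith) (by linarith), ← e, det_mul,
      Complex.mul_re, det_im_eq_zero hA', zero_mul, sub_zero]

theorem rank_conj_of_isUnit {L X : Matrix n n ℂ} (hL : IsUnit L.det) :
    (L * X * Lᴴ).rank = X.rank := by
  rw [rank_mul_eq_left_of_isUnit_det _ _ (by rw [det_conjTranspose]; exact hL.star),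
    rank_mul_eq_right_of_isUnit_det _ _ hL]

end RankLemmas

/-! ### Second-order statistics of the auxiliary variable. -/

section DirtyPaper

variable {n k l : Type*} [Fintype n] [DecidableEq n] [Fintype k] [DecidableEq k]
  [Fintype l] [DecidableEq l]

/-- Covariance of the auxiliary variable `U = N + W X`, where `X` has covariance `S` and `N` is
white. -/
def auxCov (S : Matrix n n ℂ) (W : Matrix k n ℂ) : Matrix k k ℂ := 1 + W * S * Wᴴ

/-- Cross-covariance of `X + E N` and the auxiliary variable `U = N + W X`. -/
def auxCross (S : Matrix n n ℂ) (E : Matrix n k ℂ) (W : Matrix k n ℂ) : Matrix n k ℂ :=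
  S * Wᴴ + E

/-- Covariance of `X + E N` given the auxiliary variable `U = N + W X`. -/
noncomputable def errorCov (S : Matrix n n ℂ) (E : Matrix n k ℂ) (W : Matrix k n ℂ) :
    Matrix n n ℂ :=
  S + E * Eᴴ - auxCross S E W * (auxCov S W)⁻¹ * (auxCross S E W)ᴴ

variable {S : Matrix n n ℂ}

theorem posDef_auxCov (hS : S.PosSemidef) (W : Matrix k n ℂ) : (auxCov S W).PosDef :=
  posDef_one_add (hS.mul_mul_conjTranspose_same W)

/-- The joint covariance of `U` and `X + E N` is the sum of the contributions of `X` and of `N`,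
each of Gram form. -/
theorem posSemidef_joint (hS : S.PosSemidef) (E : Matrix n k ℂ) (W : Matrix k n ℂ) :
    (fromBlocks (auxCov S W) (auxCross S E W)ᴴ (auxCross S E W) (S + E * Eᴴ)).PosSemidef := by
  have h1 := hS.mul_mul_conjTranspose_same (fromRows W (1 : Matrix n n ℂ))
  have h2 := posSemidef_self_mul_conjTranspose (fromRows (1 : Matrix k k ℂ) E)
  convert h1.add h2 using 1
  rw [conjTranspose_fromRows_eq_fromCols_conjTranspose,
    conjTranspose_fromRows_eq_fromCols_conjTranspose, fromRows_mul, fromRows_mul_fromCols,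
    fromRows_mul_fromCols, fromBlocks_add]
  simp only [auxCov, auxCross, conjTranspose_add, conjTranspose_mul, conjTranspose_conjTranspose,
    hS.1.eq, conjTranspose_one, Matrix.mul_one, Matrix.one_mul]
  congr 1
  exact add_comm _ _

theorem posSemidef_errorCov (hS : S.PosSemidef) (E : Matrix n k ℂ) (W : Matrix k n ℂ) :
    (errorCov S E W).PosSemidef := by
  have hC := posDef_auxCov hS W
  let := hC.isUnit.invertible
  have h := (hC.fromBlocks₁₁ (auxCross S E W)ᴴ (S + E * Eᴴ)).1
    (by rw [conjTranspose_conjTranspose]; exact posSemidef_joint hS E W)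
  rwa [conjTranspose_conjTranspose] at h

theorem posSemidef_add_self_mul (hS : S.PosSemidef) (E : Matrix n k ℂ) :
    (S + E * Eᴴ).PosSemidef := hS.add (posSemidef_self_mul_conjTranspose E)

/-- Schur complement with respect to `U`: given `U`, the output has covariance `1 + Hb * errorCov *
Hbᴴ`. -/
theorem det_joint_output (hS : S.PosSemidef) (E : Matrix n k ℂ) (W : Matrix k n ℂ)
    (Hb : Matrix l n ℂ) :
    (fromBlocks (auxCov S W) ((auxCross S E W)ᴴ * Hbᴴ) (Hb * auxCross S E W)
      (1 + Hb * (S + E * Eᴴ) * Hbᴴ)).det =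
      (auxCov S W).det * (1 + Hb * errorCov S E W * Hbᴴ).det := by
  let := (posDef_auxCov hS W).isUnit.invertible
  rw [det_fromBlocks₁₁, invOf_eq_nonsing_inv, errorCov, add_sub_assoc]
  simp only [Matrix.mul_sub, Matrix.sub_mul, Matrix.mul_assoc]

/-- Knowledge of the interference at the receiver does not reduce the rate of the scheme. -/
theorem det_output_le (hS : S.PosSemidef) (E : Matrix n k ℂ) (W : Matrix k n ℂ)
    (Hb : Matrix l n ℂ) :
    (1 + Hb * (S + E * Eᴴ) * Hbᴴ).det.re ≤
      (auxCov S W).det.re * (1 + Hb * errorCov S E W * Hbᴴ).det.re *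
        (1 + (Hb * E) * (Hb * E)ᴴ).det.re := by
  set F := Hb * E with hF
  set B := 1 + Hb * (S + E * Eᴴ) * Hbᴴ with hB
  set L := (auxCross S E W)ᴴ * Hbᴴ with hL
  have hBp : B.PosDef :=
    posDef_one_add ((posSemidef_add_self_mul hS E).mul_mul_conjTranspose_same Hb)
  have hDp : (1 + F * Fᴴ).PosDef := posDef_one_add (posSemidef_self_mul_conjTranspose F)
  let := hBp.isUnit.invertible
  let := hDp.isUnit.invertible
  -- The error covariance of `N` when it is estimated from `F N` plus white noise, i.e. with the
  -- interference removed. Its determinant is the inverse of `det (1 + F Fᴴ)`.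
  set E₀ := 1 - Fᴴ * (1 + F * Fᴴ)⁻¹ * Fᴴᴴ with hE₀
  have hJ0 : (fromBlocks 1 Fᴴ Fᴴᴴ (1 + F * Fᴴ)).PosSemidef := by
    convert (posSemidef_self_mul_conjTranspose (fromRows 1 F)).add
      (posSemidef_self_mul_conjTranspose (fromRows (0 : Matrix k l ℂ) 1)) using 1
    rw [conjTranspose_fromRows_eq_fromCols_conjTranspose,
      conjTranspose_fromRows_eq_fromCols_conjTranspose, fromRows_mul_fromCols,
      fromRows_mul_fromCols, fromBlocks_add]
    simp [add_comm]
  have hE₀p : E₀.PosSemidef := (PosDef.fromBlocks₂₂ 1 Fᴴ hDp).1 hJ0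
  have hdetE₀ : (1 + F * Fᴴ).det * E₀.det = 1 := by
    have h := det_fromBlocks₂₂ 1 Fᴴ Fᴴᴴ (1 + F * Fᴴ)
    rw [det_fromBlocks_one₁₁, conjTranspose_conjTranspose, add_sub_cancel_right, det_one,
      invOf_eq_nonsing_inv] at h
    rw [hE₀, conjTranspose_conjTranspose, ← h]
  have hJ1 : (fromBlocks (1 - E₀) Fᴴ Fᴴᴴ (1 + F * Fᴴ)).PosSemidef := by
    rw [PosDef.fromBlocks₂₂ _ _ hDp]
    have : 1 - E₀ - Fᴴ * (1 + F * Fᴴ)⁻¹ * Fᴴᴴ = 0 := by rw [hE₀]; abel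
    rw [this]; exact PosSemidef.zero
  -- Removing `E₀` from the covariance of `U` keeps the joint covariance with the output positive
  -- semidefinite, because the interference adds a positive semidefinite term. Hence the error
  -- covariance of `U` given the output dominates `E₀`.
  have hJ2 : (fromBlocks (auxCov S W - E₀) L Lᴴ B).PosSemidef := by
    convert hJ1.add (hS.mul_mul_conjTranspose_same (fromRows W Hb)) using 1
    rw [conjTranspose_fromRows_eq_fromCols_conjTranspose, fromRows_mul, fromRows_mul_fromCols,
      fromBlocks_add]
    simp only [hL, hB, hF, auxCov, auxCross, conjTranspose_add, conjTranspose_mul,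
      conjTranspose_conjTranspose, hS.1.eq, Matrix.mul_add, Matrix.add_mul, Matrix.mul_assoc]
    congr 1 <;> abel
  have hS1 := (PosDef.fromBlocks₂₂ _ _ hBp).1 hJ2
  have hle : E₀.det.re ≤ (auxCov S W - L * B⁻¹ * Lᴴ).det.re :=
    det_re_le_of_sub hE₀p (by rwa [sub_right_comm])
  have hSc : (auxCov S W - L * B⁻¹ * Lᴴ).PosSemidef := by
    have := hE₀p.add hS1
    rwa [sub_right_comm, add_sub_cancel] at this
  have hdet : B.det * (auxCov S W - L * B⁻¹ * Lᴴ).det =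
      (auxCov S W).det * (1 + Hb * errorCov S E W * Hbᴴ).det := by
    have h := det_joint_output hS E W Hb
    rw [← hL, ← hB] at h
    have hLh : Lᴴ = Hb * auxCross S E W := by
      rw [hL, conjTranspose_mul, conjTranspose_conjTranspose, conjTranspose_conjTranspose]
    rw [← h, ← hLh, det_fromBlocks₂₂, invOf_eq_nonsing_inv]
  have hQ := posSemidef_one_add ((posSemidef_errorCov hS E W).mul_mul_conjTranspose_same Hb)
  have e1 : (auxCov S W).det.re * (1 + Hb * errorCov S E W * Hbᴴ).det.re =
      B.det.re * (auxCov S W - L * B⁻¹ * Lᴴ).det.re := by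
    have := congr_arg Complex.re hdet
    rw [Complex.mul_re, Complex.mul_re, det_im_eq_zero hBp.posSemidef, det_im_eq_zero hQ] at this
    linarith
  have e2 : (1 + F * Fᴴ).det.re * E₀.det.re = 1 := by
    have := congr_arg Complex.re hdetE₀
    rw [Complex.mul_re, det_im_eq_zero hE₀p, Complex.one_re] at this
    linarith
  have hB0 := det_re_nonneg hBp.posSemidef
  have hF0 := det_re_nonneg hDp.posSemidef
  rw [e1]
  calc B.det.re = B.det.re * ((1 + F * Fᴴ).det.re * E₀.det.re) := by rw [e2, mul_one]
    _ ≤ B.det.re * ((1 + F * Fᴴ).det.re * (auxCov S W - L * B⁻¹ * Lᴴ).det.re) := by gcongr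
    _ = _ := by ring

/-- When the auxiliary variable is, up to a part `N'` that is uncorrelated with the input, a
function of the input, the rank of the error covariance is determined. -/
theorem rank_errorCov_add (hS : S.PosSemidef) (E : Matrix n k ℂ) (W : Matrix k n ℂ)
    {N : Matrix k k ℂ} (hN : N.PosSemidef) (hK : (auxCross S E W)ᴴ = W * (S + E * Eᴴ))
    (hC : auxCov S W = N + W * (S + E * Eᴴ) * Wᴴ) :
    Fintype.card k + (errorCov S E W).rank = N.rank + (S + E * Eᴴ).rank := by
  set A := S + E * Eᴴ with hA
  have hAp : A.PosSemidef := posSemidef_add_self_mul hS E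
  have hCp := posDef_auxCov hS W
  have hCu : IsUnit (auxCov S W).det := (isUnit_iff_isUnit_det _).1 hCp.isUnit
  set K := auxCross S E W with hKdef
  set C := auxCov S W with hCdef
  have hK' : K = A * Wᴴ := by
    rw [← conjTranspose_conjTranspose K, hK, conjTranspose_mul, hAp.1.eq]
  -- Eliminating the total input leaves `diag (N, A)`; eliminating `U` in `h2` leaves `diag (C,
  -- errorCov)`. Both are congruences, so the ranks agree, and `C` is invertible.
  have h1 : fromBlocks C Kᴴ K A = fromBlocks 1 W 0 1 * fromBlocks N 0 0 A *
      (fromBlocks 1 W 0 1)ᴴ := by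
    rw [fromBlocks_conjTranspose, fromBlocks_multiply, fromBlocks_multiply]
    have hK2 : W * Aᴴ = W * A := by rw [hAp.1.eq]
    simp [hK', hC, hK2]
  have hCi : (C⁻¹)ᴴ = C⁻¹ := by rw [conjTranspose_nonsing_inv, hCp.1.eq]
  have h2 : fromBlocks C Kᴴ K A = fromBlocks 1 0 (K * C⁻¹) 1 *
      fromBlocks C 0 0 (errorCov S E W) * (fromBlocks 1 0 (K * C⁻¹) 1)ᴴ := by
    rw [fromBlocks_conjTranspose, fromBlocks_multiply, fromBlocks_multiply]
    have e1 : K * C⁻¹ * C = K := by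
      rw [Matrix.mul_assoc, nonsing_inv_mul _ hCu, Matrix.mul_one]
    have e2 : C * (C⁻¹ * Kᴴ) = Kᴴ := by
      rw [← Matrix.mul_assoc, mul_nonsing_inv _ hCu, Matrix.one_mul]
    simp [conjTranspose_mul, hCi, e1, e2, errorCov, ← hKdef, ← hCdef, ← hA, ← Matrix.mul_assoc]
  have r1 := congr_arg rank h1
  have r2 := congr_arg rank h2
  rw [rank_conj_of_isUnit (by simp), rank_fromBlocks_diagonal hN hAp] at r1
  rw [rank_conj_of_isUnit (by simp), rank_fromBlocks_diagonal hCp.posSemidef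
    (posSemidef_errorCov hS E W), rank_of_isUnit _ hCp.isUnit] at r2
  omega

/-- The inflation factor shrinks as the amplitude grows, so the law of `U` does not change with the
power. -/
theorem auxCov_scale (S : Matrix n n ℂ) (W : Matrix k n ℂ) {s : ℝ} (hs : s ≠ 0) :
    auxCov (((s ^ 2 : ℝ) : ℂ) • S) (((s⁻¹ : ℝ) : ℂ) • W) = auxCov S W := by
  rw [auxCov, auxCov, conjTranspose_smul, Complex.star_def, Complex.conj_ofReal]
  simp only [Matrix.mul_smul, Matrix.smul_mul, smul_smul]
  rw [← Complex.ofReal_mul, ← Complex.ofReal_mul]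
  have : s⁻¹ * (s ^ 2 * s⁻¹) = 1 := by field_simp
  simp [this]

theorem auxCross_scale (S : Matrix n n ℂ) (E : Matrix n k ℂ) (W : Matrix k n ℂ) {s : ℝ}
    (hs : s ≠ 0) :
    auxCross (((s ^ 2 : ℝ) : ℂ) • S) ((s : ℂ) • E) (((s⁻¹ : ℝ) : ℂ) • W) =
      (s : ℂ) • auxCross S E W := by
  rw [auxCross, auxCross, conjTranspose_smul, Complex.star_def, Complex.conj_ofReal, smul_add]
  simp only [Matrix.mul_smul, Matrix.smul_mul, smul_smul]
  rw [← Complex.ofReal_mul]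
  congr 3
  field_simp

theorem errorCov_scale (S : Matrix n n ℂ) (E : Matrix n k ℂ) (W : Matrix k n ℂ) {s : ℝ}
    (hs : s ≠ 0) :
    errorCov (((s ^ 2 : ℝ) : ℂ) • S) ((s : ℂ) • E) (((s⁻¹ : ℝ) : ℂ) • W) =
      ((s ^ 2 : ℝ) : ℂ) • errorCov S E W := by
  rw [errorCov, errorCov, auxCross_scale _ _ _ hs, auxCov_scale _ _ hs, conjTranspose_smul,
    conjTranspose_smul, Complex.star_def, Complex.conj_ofReal, smul_sub, smul_add]
  simp only [Matrix.mul_smul, Matrix.smul_mul, smul_smul]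
  rw [← Complex.ofReal_mul, sq]

end DirtyPaper

/-! ### Uniqueness, scaling and rank for the pseudo-inverse. -/

section PseudoInverse

variable {m n : ℕ}

/-- The Penrose equations determine the pseudo-inverse. -/
theorem eq_pinv_of_penrose {A : Matrix (Fin m) (Fin n) ℂ} {X : Matrix (Fin n) (Fin m) ℂ}
    (h1 : A * X * A = A) (h2 : X * A * X = X) (h3 : (A * X)ᴴ = A * X) (h4 : (X * A)ᴴ = X * A) :
    X = pinv A := by
  obtain ⟨g1, g2, g3, g4⟩ := pinv_penrose A
  set Y := pinv A
  have hAX : A * X = A * Y := by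
    have e : A * Y * (A * X) = A * X := by rw [← Matrix.mul_assoc, g1]
    have := congr_arg conjTranspose e
    rw [conjTranspose_mul, g3, h3, ← Matrix.mul_assoc, h1] at this
    exact this.symm
  have hXA : X * A = Y * A := by
    have e : X * A * (Y * A) = X * A := by rw [Matrix.mul_assoc, ← Matrix.mul_assoc A, g1]
    have := congr_arg conjTranspose e
    rw [conjTranspose_mul, g4, h4, Matrix.mul_assoc, ← Matrix.mul_assoc A, h1] at this
    exact this.symm
  calc X = X * A * X := h2.symm
    _ = Y * A * Y := by rw [hXA, Matrix.mul_assoc, hAX, ← Matrix.mul_assoc]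
    _ = Y := g2

theorem pinv_real_smul (A : Matrix (Fin m) (Fin n) ℂ) {s : ℝ} (hs : s ≠ 0) :
    pinv ((s : ℂ) • A) = ((s⁻¹ : ℝ) : ℂ) • pinv A := by
  obtain ⟨g1, g2, g3, g4⟩ := pinv_penrose A
  have hs' : (s : ℂ) ≠ 0 := by exact_mod_cast hs
  have e1 : ((s : ℂ) • A) * (((s⁻¹ : ℝ) : ℂ) • pinv A) = A * pinv A := by
    rw [Matrix.smul_mul, Matrix.mul_smul, smul_smul, Complex.ofReal_inv, mul_inv_cancel₀ hs',
      one_smul]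
  have e2 : (((s⁻¹ : ℝ) : ℂ) • pinv A) * ((s : ℂ) • A) = pinv A * A := by
    rw [Matrix.smul_mul, Matrix.mul_smul, smul_smul, Complex.ofReal_inv, inv_mul_cancel₀ hs',
      one_smul]
  refine (eq_pinv_of_penrose ?_ ?_ ?_ ?_).symm
  · rw [e1, Matrix.mul_smul, g1]
  · rw [e2, Matrix.mul_smul, g2]
  · rw [e1, g3]
  · rw [e2, g4]

theorem rank_one_sub_pinv_mul (A : Matrix (Fin m) (Fin n) ℂ) :
    (1 - pinv A * A).PosSemidef ∧ (1 - pinv A * A).rank + A.rank = n := by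
  obtain ⟨g1, g2, g3, g4⟩ := pinv_penrose A
  obtain ⟨-, h1, h2⟩ := rank_add_rank_one_sub (Q := pinv A * A) g4 (by
    rw [Matrix.mul_assoc, ← Matrix.mul_assoc A, g1])
  refine ⟨h1, ?_⟩
  have : (pinv A * A).rank = A.rank := by
    refine le_antisymm (rank_mul_le_right _ _) ?_
    calc A.rank = (A * (pinv A * A)).rank := by rw [← Matrix.mul_assoc, g1]
      _ ≤ _ := rank_mul_le_right _ _
  rw [this, Fintype.card_fin] at h2
  exact h2

end PseudoInverse

/-! ### The two rates as differences of log-determinants. -/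

section Rates

variable {t₁ t₂ r₁ r₂ : ℕ}

/-- The matrix through which the private cognitive signal enters the joint input. -/
def privateInput (t₁ : ℕ) {t₂ : ℕ} (T₂ : Matrix (Fin t₂) (Fin t₂) ℂ) :
    Matrix (TxIndex t₁ t₂) (Fin t₂) ℂ := fromRows 0 T₂

theorem privateInput_mul_conjTranspose (T₂ : Matrix (Fin t₂) (Fin t₂) ℂ) :
    privateInput t₁ T₂ * (privateInput t₁ T₂)ᴴ = fromBlocks 0 0 0 (T₂ * T₂ᴴ) := by
  rw [privateInput, conjTranspose_fromRows_eq_fromCols_conjTranspose, fromRows_mul_fromCols]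
  simp

theorem inputCov_eq (T₁ : Matrix (TxIndex t₁ t₂) (TxIndex t₁ t₂) ℂ)
    (T₂ : Matrix (Fin t₂) (Fin t₂) ℂ) :
    inputCov T₁ T₂ = T₁ * T₁ᴴ + privateInput t₁ T₂ * (privateInput t₁ T₂)ᴴ := by
  rw [privateInput_mul_conjTranspose]; rfl

theorem posSemidef_inputCov (T₁ : Matrix (TxIndex t₁ t₂) (TxIndex t₁ t₂) ℂ)
    (T₂ : Matrix (Fin t₂) (Fin t₂) ℂ) : (inputCov T₁ T₂).PosSemidef := by
  rw [inputCov_eq]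
  exact posSemidef_add_self_mul (posSemidef_self_mul_conjTranspose T₁) _

theorem Hbar₁_mul_privateInput (h : ChannelState t₁ t₂ r₁ r₂) (T₂ : Matrix (Fin t₂) (Fin t₂) ℂ) :
    h.Hbar₁ * privateInput t₁ T₂ = h.H₂₁ * T₂ := by
  rw [ChannelState.Hbar₁, privateInput, fromCols_mul_fromRows, Matrix.mul_zero, zero_add]

theorem Hbar₂_mul_privateInput (h : ChannelState t₁ t₂ r₁ r₂) (T₂ : Matrix (Fin t₂) (Fin t₂) ℂ) :
    h.Hbar₂ * privateInput t₁ T₂ = h.H₂₂ * T₂ := by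
  rw [ChannelState.Hbar₂, privateInput, fromCols_mul_fromRows, Matrix.mul_zero, zero_add]

theorem primaryRate_eq (h : ChannelState t₁ t₂ r₁ r₂)
    (T₁ : Matrix (TxIndex t₁ t₂) (TxIndex t₁ t₂) ℂ) (T₂ : Matrix (Fin t₂) (Fin t₂) ℂ) :
    h.primaryRate T₁ T₂ = logDet (h.Hbar₁ * inputCov T₁ T₂ * h.Hbar₁ᴴ) -
      logDet (h.H₂₁ * (T₂ * T₂ᴴ) * h.H₂₁ᴴ) := by
  have e : h.Hbar₁ * inputCov T₁ T₂ * h.Hbar₁ᴴ =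
      h.Hbar₁ * (T₁ * T₁ᴴ) * h.Hbar₁ᴴ + h.H₂₁ * (T₂ * T₂ᴴ) * h.H₂₁ᴴ := by
    rw [inputCov_eq, Matrix.mul_add, Matrix.add_mul, ← Matrix.mul_assoc _ (privateInput t₁ T₂),
      Matrix.mul_assoc _ (privateInput t₁ T₂)ᴴ, ← conjTranspose_mul, Hbar₁_mul_privateInput,
      conjTranspose_mul]
    simp only [Matrix.mul_assoc]
  have h1 := one_le_det_one_add ((posSemidef_inputCov T₁ T₂).mul_mul_conjTranspose_same h.Hbar₁)
  have h2 := one_le_det_one_add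
    ((posSemidef_self_mul_conjTranspose T₂).mul_mul_conjTranspose_same h.H₂₁)
  rw [logDet, logDet, ← Real.log_div (by linarith) (by linarith), e, ← add_assoc,
    ChannelState.primaryRate]

theorem cognitiveOutputCov_eq (h : ChannelState t₁ t₂ r₁ r₂)
    (T₁ : Matrix (TxIndex t₁ t₂) (TxIndex t₁ t₂) ℂ) (T₂ : Matrix (Fin t₂) (Fin t₂) ℂ) :
    h.cognitiveOutputCov T₁ T₂ = 1 + h.Hbar₂ * inputCov T₁ T₂ * h.Hbar₂ᴴ := by
  rw [ChannelState.cognitiveOutputCov, inputCov_eq, Matrix.mul_add, Matrix.add_mul,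
    ← Matrix.mul_assoc _ (privateInput t₁ T₂),
    Matrix.mul_assoc _ (privateInput t₁ T₂)ᴴ, ← conjTranspose_mul, Hbar₂_mul_privateInput,
    conjTranspose_mul, add_assoc]
  simp only [Matrix.mul_assoc]
  rw [add_comm (h.Hbar₂ * _)]

theorem dpcJointCov_eq (h : ChannelState t₁ t₂ r₁ r₂)
    (T₁ : Matrix (TxIndex t₁ t₂) (TxIndex t₁ t₂) ℂ) (T₂ : Matrix (Fin t₂) (Fin t₂) ℂ)
    (W : Matrix (Fin t₂) (TxIndex t₁ t₂) ℂ) :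
    h.dpcJointCov T₁ T₂ W = fromBlocks (auxCov (T₁ * T₁ᴴ) W)
      ((auxCross (T₁ * T₁ᴴ) (privateInput t₁ T₂) W)ᴴ * h.Hbar₂ᴴ)
      (h.Hbar₂ * auxCross (T₁ * T₁ᴴ) (privateInput t₁ T₂) W)
      (1 + h.Hbar₂ * (T₁ * T₁ᴴ + privateInput t₁ T₂ * (privateInput t₁ T₂)ᴴ) * h.Hbar₂ᴴ) := by
  have e : (privateInput t₁ T₂)ᴴ * h.Hbar₂ᴴ = T₂ᴴ * h.H₂₂ᴴ := by
    rw [← conjTranspose_mul, Hbar₂_mul_privateInput, conjTranspose_mul]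
  rw [ChannelState.dpcJointCov, cognitiveOutputCov_eq, inputCov_eq, auxCov, auxCross]
  congr 1
  · rw [conjTranspose_add, Matrix.add_mul, e, add_comm, conjTranspose_mul,
      conjTranspose_conjTranspose, (posSemidef_self_mul_conjTranspose T₁).1.eq]
  · rw [Matrix.mul_add, Hbar₂_mul_privateInput, add_comm]
    simp only [Matrix.mul_assoc]

theorem cognitiveRate_eq (h : ChannelState t₁ t₂ r₁ r₂)
    (T₁ : Matrix (TxIndex t₁ t₂) (TxIndex t₁ t₂) ℂ) (T₂ : Matrix (Fin t₂) (Fin t₂) ℂ)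
    (W : Matrix (Fin t₂) (TxIndex t₁ t₂) ℂ) :
    h.cognitiveRate T₁ T₂ W = logDet (h.Hbar₂ * inputCov T₁ T₂ * h.Hbar₂ᴴ) -
      logDet (h.Hbar₂ * errorCov (T₁ * T₁ᴴ) (privateInput t₁ T₂) W * h.Hbar₂ᴴ) -
      Real.log (auxCov (T₁ * T₁ᴴ) W).det.re := by
  have hS := posSemidef_self_mul_conjTranspose T₁
  have hQ := (posSemidef_errorCov hS (privateInput t₁ T₂) W).mul_mul_conjTranspose_same h.Hbar₂
  have h1 := one_le_det_one_add ((posSemidef_inputCov T₁ T₂).mul_mul_conjTranspose_same h.Hbar₂)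
  have h2 := one_le_det_one_add hQ
  have h3 : 1 ≤ (auxCov (T₁ * T₁ᴴ) W).det.re :=
    one_le_det_one_add (hS.mul_mul_conjTranspose_same W)
  rw [ChannelState.cognitiveRate, dpcJointCov_eq, det_joint_output hS, cognitiveOutputCov_eq,
    Complex.mul_re, det_im_eq_zero (posDef_auxCov hS W).posSemidef, zero_mul, sub_zero,
    Real.log_div (by linarith) (by positivity), Real.log_mul (by linarith) (by linarith),
    logDet, logDet]
  ring

/-- Holds for each channel realization and every inflation factor, so `W` disappears from the
converse. -/
theorem cognitiveRate_le (h : ChannelState t₁ t₂ r₁ r₂)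
    (T₁ : Matrix (TxIndex t₁ t₂) (TxIndex t₁ t₂) ℂ) (T₂ : Matrix (Fin t₂) (Fin t₂) ℂ)
    (W : Matrix (Fin t₂) (TxIndex t₁ t₂) ℂ) :
    h.cognitiveRate T₁ T₂ W ≤ logDet (h.H₂₂ * (T₂ * T₂ᴴ) * h.H₂₂ᴴ) := by
  have hS := posSemidef_self_mul_conjTranspose T₁
  have hQ := (posSemidef_errorCov hS (privateInput t₁ T₂) W).mul_mul_conjTranspose_same h.Hbar₂
  have h1 := one_le_det_one_add ((posSemidef_inputCov T₁ T₂).mul_mul_conjTranspose_same h.Hbar₂)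
  have h2 := one_le_det_one_add hQ
  have h3 : 1 ≤ (auxCov (T₁ * T₁ᴴ) W).det.re :=
    one_le_det_one_add (hS.mul_mul_conjTranspose_same W)
  have h4 := one_le_det_one_add
    ((posSemidef_self_mul_conjTranspose T₂).mul_mul_conjTranspose_same h.H₂₂)
  have h5 := det_output_le hS (privateInput t₁ T₂) W h.Hbar₂
  have e : (h.H₂₂ * T₂) * (h.H₂₂ * T₂)ᴴ = h.H₂₂ * (T₂ * T₂ᴴ) * h.H₂₂ᴴ := by
    rw [conjTranspose_mul]; simp only [Matrix.mul_assoc]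
  rw [Hbar₂_mul_privateInput, e, ← inputCov_eq] at h5
  have h6 := Real.log_le_log (by linarith) h5
  rw [Real.log_mul (by positivity) (by linarith), Real.log_mul (by linarith) (by linarith)] at h6
  rw [cognitiveRate_eq, logDet, logDet, logDet]
  linarith

end Rates

/-! ### Expected rates: converse bound and scaling limits. -/

section Fading

variable {Ω : Type*} [MeasurableSpace Ω] {μ : Measure Ω} {t₁ t₂ r₁ r₂ : ℕ}

theorem IsLogIntegrable.hasLogMoment {m n : ℕ} {A : Ω → Matrix (Fin m) (Fin n) ℂ}
    (hA : IsLogIntegrable μ A) : HasLogMoment μ A := ⟨hA.measurable, hA.integrable⟩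

theorem HasLogMoment.fromCols {r a b : ℕ} {A : Ω → Matrix (Fin r) (Fin a) ℂ}
    {B : Ω → Matrix (Fin r) (Fin b) ℂ} (hA : HasLogMoment μ A) (hB : HasLogMoment μ B) :
    HasLogMoment μ fun ω => fromCols (A ω) (B ω) := by
  have he : MeasurableEntries fun ω => Matrix.fromCols (A ω) (B ω) := by
    rintro i (j | j)
    · exact hA.entries i j
    · exact hB.entries i j
  have hf : ∀ ω, frobSq (Matrix.fromCols (A ω) (B ω)) = frobSq (A ω) + frobSq (B ω) := by
    intro ω
    simp [frobSq, Fintype.sum_sum_type, Finset.sum_add_distrib]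
  have hm : Measurable fun ω => frobSq (Matrix.fromCols (A ω) (B ω)) :=
    Finset.measurable_sum _ fun i _ => Finset.measurable_sum _ fun j _ =>
      (he i j).norm.pow_const 2
  refine ⟨he, (hA.integrable.add hB.integrable).mono'
    (Real.measurable_log.comp (measurable_const.add hm)).aestronglyMeasurable
    (Eventually.of_forall fun ω => ?_)⟩
  have h1 := frobSq_nonneg (A ω)
  have h2 := frobSq_nonneg (B ω)
  rw [hf, Real.norm_of_nonneg (Real.log_nonneg (by linarith)), Pi.add_apply,
    ← Real.log_mul (by positivity) (by positivity)]
  exact Real.log_le_log (by positivity) (by nlinarith)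

/-- A covariance supported on the second block of antennas sees only `B`, and padding by zero blocks
preserves its rank. -/
theorem IsGenericFading.fromCols_right {r : ℕ} {A : Ω → Matrix (Fin r) (Fin t₁) ℂ}
    {B : Ω → Matrix (Fin r) (Fin t₂) ℂ}
    (h : IsGenericFading μ fun ω => fromCols (A ω) (B ω)) : IsGenericFading μ B := by
  intro D hD
  obtain ⟨S, rfl⟩ := exists_eq_mul_conjTranspose hD
  filter_upwards [h _ (posSemidef_self_mul_conjTranspose (privateInput t₁ S))] with ω hω
  have e1 : fromCols (A ω) (B ω) * (privateInput t₁ S * (privateInput t₁ S)ᴴ) *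
      (fromCols (A ω) (B ω))ᴴ = B ω * (S * Sᴴ) * (B ω)ᴴ := by
    have : fromCols (A ω) (B ω) * privateInput t₁ S = B ω * S := by
      rw [privateInput, fromCols_mul_fromRows, Matrix.mul_zero, zero_add]
    rw [← Matrix.mul_assoc, Matrix.mul_assoc _ (privateInput t₁ S)ᴴ, ← conjTranspose_mul, this,
      conjTranspose_mul]
    simp only [Matrix.mul_assoc]
  rwa [e1, privateInput_mul_conjTranspose, rank_fromBlocks_diagonal PosSemidef.zero hD, rank_zero,
    zero_add] at hω

variable {H : Ω → ChannelState t₁ t₂ r₁ r₂}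

theorem IsFadingCRC.logMoment_Hbar₁ (hH : IsFadingCRC μ H) :
    HasLogMoment μ fun ω => (H ω).Hbar₁ := hH.log₁₁.hasLogMoment.fromCols hH.log₂₁.hasLogMoment

theorem IsFadingCRC.logMoment_Hbar₂ (hH : IsFadingCRC μ H) :
    HasLogMoment μ fun ω => (H ω).Hbar₂ := hH.log₁₂.hasLogMoment.fromCols hH.log₂₂.hasLogMoment

theorem IsFadingCRC.generic_H₂₁ (hH : IsFadingCRC μ H) :
    IsGenericFading μ fun ω => (H ω).H₂₁ := hH.generic₁.fromCols_right

variable [IsProbabilityMeasure μ]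

theorem IsFadingCRC.integrable_primaryRate (hH : IsFadingCRC μ H)
    (T₁ : Matrix (TxIndex t₁ t₂) (TxIndex t₁ t₂) ℂ) (T₂ : Matrix (Fin t₂) (Fin t₂) ℂ) :
    Integrable (fun ω => (H ω).primaryRate T₁ T₂) μ := by
  simp only [primaryRate_eq]
  exact (hH.logMoment_Hbar₁.integrable_logDet (posSemidef_inputCov T₁ T₂)).sub
    (hH.log₂₁.hasLogMoment.integrable_logDet (posSemidef_self_mul_conjTranspose T₂))

theorem IsFadingCRC.integrable_cognitiveRate (hH : IsFadingCRC μ H)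
    (T₁ : Matrix (TxIndex t₁ t₂) (TxIndex t₁ t₂) ℂ) (T₂ : Matrix (Fin t₂) (Fin t₂) ℂ)
    (W : Matrix (Fin t₂) (TxIndex t₁ t₂) ℂ) :
    Integrable (fun ω => (H ω).cognitiveRate T₁ T₂ W) μ := by
  simp only [cognitiveRate_eq]
  exact ((hH.logMoment_Hbar₂.integrable_logDet (posSemidef_inputCov T₁ T₂)).sub
    (hH.logMoment_Hbar₂.integrable_logDet
      (posSemidef_errorCov (posSemidef_self_mul_conjTranspose T₁) _ W))).sub (integrable_const _)

theorem IsFadingCRC.Rp_eq (hH : IsFadingCRC μ H)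
    (T₁ : Matrix (TxIndex t₁ t₂) (TxIndex t₁ t₂) ℂ) (T₂ : Matrix (Fin t₂) (Fin t₂) ℂ) :
    Rp μ H T₁ T₂ = ∫ ω, logDet ((H ω).Hbar₁ * inputCov T₁ T₂ * (H ω).Hbar₁ᴴ) ∂μ -
      ∫ ω, logDet ((H ω).H₂₁ * (T₂ * T₂ᴴ) * (H ω).H₂₁ᴴ) ∂μ := by
  simp only [Rp, primaryRate_eq]
  exact integral_sub (hH.logMoment_Hbar₁.integrable_logDet (posSemidef_inputCov T₁ T₂))
    (hH.log₂₁.hasLogMoment.integrable_logDet (posSemidef_self_mul_conjTranspose T₂))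

theorem IsFadingCRC.Rc_eq (hH : IsFadingCRC μ H)
    (T₁ : Matrix (TxIndex t₁ t₂) (TxIndex t₁ t₂) ℂ) (T₂ : Matrix (Fin t₂) (Fin t₂) ℂ)
    (W : Matrix (Fin t₂) (TxIndex t₁ t₂) ℂ) :
    Rc μ H T₁ T₂ W = ∫ ω, logDet ((H ω).Hbar₂ * inputCov T₁ T₂ * (H ω).Hbar₂ᴴ) ∂μ -
      ∫ ω, logDet ((H ω).Hbar₂ * errorCov (T₁ * T₁ᴴ) (privateInput t₁ T₂) W *
        (H ω).Hbar₂ᴴ) ∂μ - Real.log (auxCov (T₁ * T₁ᴴ) W).det.re := by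
  have h1 := hH.logMoment_Hbar₂.integrable_logDet (posSemidef_inputCov T₁ T₂)
  have h2 := hH.logMoment_Hbar₂.integrable_logDet
      (posSemidef_errorCov (posSemidef_self_mul_conjTranspose T₁) (privateInput t₁ T₂) W)
  simp only [Rc, cognitiveRate_eq]
  refine (integral_sub (h1.sub h2) (integrable_const _)).trans ?_
  refine (congr_arg (· - _) (integral_sub h1 h2)).trans ?_
  simp

theorem trace_fromBlocks_zero (A : Matrix (Fin t₂) (Fin t₂) ℂ) :
    (fromBlocks (0 : Matrix (Fin t₁) (Fin t₁) ℂ) 0 0 A).trace = A.trace := by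
  simp [trace]

theorem trace_inputCov_le {Pp Pc : ℝ} {T₁ : Matrix (TxIndex t₁ t₂) (TxIndex t₁ t₂) ℂ}
    {T₂ : Matrix (Fin t₂) (Fin t₂) ℂ} (h : PowerFeasible Pp Pc T₁ T₂) :
    (inputCov T₁ T₂).trace.re ≤ Pp + Pc := by
  obtain ⟨h1, h2⟩ := h
  have : (inputCov T₁ T₂).trace =
      (T₁ * T₁ᴴ).toBlocks₁₁.trace + ((T₁ * T₁ᴴ).toBlocks₂₂ + T₂ * T₂ᴴ).trace := by
    rw [inputCov, trace_add, trace_add, trace_fromBlocks_zero, ← add_assoc]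
    congr 1
    exact Fintype.sum_sum_type _
  rw [this, Complex.add_re]
  linarith

theorem trace_privateCov_le {Pp Pc : ℝ} {T₁ : Matrix (TxIndex t₁ t₂) (TxIndex t₁ t₂) ℂ}
    {T₂ : Matrix (Fin t₂) (Fin t₂) ℂ} (h : PowerFeasible Pp Pc T₁ T₂) :
    (T₂ * T₂ᴴ).trace.re ≤ Pp + Pc := by
  refine le_trans ?_ (trace_inputCov_le h)
  have h1 := trace_re_nonneg (posSemidef_self_mul_conjTranspose T₁)
  rw [inputCov, trace_add, trace_fromBlocks_zero, Complex.add_re]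
  linarith

/-- Upper bound on all achievable sum-rates, uniformly in the scheme. -/
theorem IsFadingCRC.sumRates_le (hH : IsFadingCRC μ H) {δ : ℝ} (hδ : 0 < δ) :
    ∃ C : ℝ, ∀ Pp Pc R : ℝ, R ∈ sumRates μ H Pp Pc →
      R ≤ ((max (min r₁ (t₁ + t₂)) (min r₂ t₂) : ℕ) + δ * t₂) * Real.log (1 + (Pp + Pc)) + C := by
  obtain ⟨C, hC⟩ := integral_logDet_sub_le hH.log₂₁.hasLogMoment hH.generic_H₂₁
    hH.log₂₂.hasLogMoment hδ
  refine ⟨(min r₁ (t₁ + t₂) : ℕ) * ∫ ω, Real.log (1 + frobSq (H ω).Hbar₁) ∂μ + C, ?_⟩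
  rintro Pp Pc R ⟨T₁, T₂, W, hP, rfl⟩
  have h1 := hH.logMoment_Hbar₁.integral_logDet_le (posSemidef_inputCov T₁ T₂)
    (trace_inputCov_le hP)
  have h2 := hC _ _ (posSemidef_self_mul_conjTranspose T₂) (trace_privateCov_le hP)
  have h3 : Rc μ H T₁ T₂ W ≤ ∫ ω, logDet ((H ω).H₂₂ * (T₂ * T₂ᴴ) * (H ω).H₂₂ᴴ) ∂μ :=
    integral_mono (hH.integrable_cognitiveRate T₁ T₂ W)
      (hH.log₂₂.hasLogMoment.integrable_logDet (posSemidef_self_mul_conjTranspose T₂))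
      fun ω => cognitiveRate_le (H ω) T₁ T₂ W
  rw [Fintype.card_fin, Fintype.card_sum, Fintype.card_fin, Fintype.card_fin] at h1
  rw [hH.Rp_eq]
  -- No sign of the powers is assumed; feasibility of the scheme forces their sum to be nonnegative.
  have hlog : 0 ≤ Real.log (1 + (Pp + Pc)) := Real.log_nonneg (by
    have := trace_re_nonneg (posSemidef_inputCov T₁ T₂)
    linarith [trace_inputCov_le hP])
  -- If the truncated difference is positive then `r₁ < t₂`, so both minima with `r₁` equal `r₁` and
  -- the left side is `min r₂ t₂`.
  have hN : min r₁ (t₁ + t₂) + (min r₂ t₂ - min r₁ t₂) ≤ max (min r₁ (t₁ + t₂)) (min r₂ t₂) := by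
    omega
  have hN' : ((min r₁ (t₁ + t₂) : ℕ) : ℝ) + (min r₂ t₂ - min r₁ t₂ : ℕ) ≤
      (max (min r₁ (t₁ + t₂)) (min r₂ t₂) : ℕ) := by exact_mod_cast hN
  have h4 := mul_le_mul_of_nonneg_right hN' hlog
  linarith

theorem inputCov_smul (T₁ : Matrix (TxIndex t₁ t₂) (TxIndex t₁ t₂) ℂ)
    (T₂ : Matrix (Fin t₂) (Fin t₂) ℂ) (s : ℝ) :
    inputCov ((s : ℂ) • T₁) ((s : ℂ) • T₂) = ((s ^ 2 : ℝ) : ℂ) • inputCov T₁ T₂ := by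
  rw [inputCov, inputCov, smul_add, fromBlocks_smul]
  simp only [conjTranspose_smul, Complex.star_def, Complex.conj_ofReal, Matrix.mul_smul,
    Matrix.smul_mul, smul_smul, smul_zero]
  rw [← Complex.ofReal_mul, sq]

theorem smul_mul_conjTranspose_smul {m n : Type*} [Fintype n] (T : Matrix m n ℂ) (s : ℝ) :
    ((s : ℂ) • T) * ((s : ℂ) • T)ᴴ = ((s ^ 2 : ℝ) : ℂ) • (T * Tᴴ) := by
  simp only [conjTranspose_smul, Complex.star_def, Complex.conj_ofReal, Matrix.mul_smul,
    Matrix.smul_mul, smul_smul]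
  rw [← Complex.ofReal_mul, sq]

theorem IsFadingCRC.tendsto_Rp (hH : IsFadingCRC μ H)
    (T₁ : Matrix (TxIndex t₁ t₂) (TxIndex t₁ t₂) ℂ) (T₂ : Matrix (Fin t₂) (Fin t₂) ℂ) :
    Tendsto (fun P : ℝ => Rp μ H ((√P : ℂ) • T₁) ((√P : ℂ) • T₂) / Real.log P) atTop
      (𝓝 (gammaP r₁ (inputCov T₁ T₂).rank (T₂ * T₂ᴴ).rank)) := by
  have h1 := tendsto_integral_logDet hH.logMoment_Hbar₁ hH.generic₁ (posSemidef_inputCov T₁ T₂)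
  have h2 := tendsto_integral_logDet hH.log₂₁.hasLogMoment hH.generic_H₂₁
    (posSemidef_self_mul_conjTranspose T₂)
  refine (h1.sub h2).congr' ?_
  filter_upwards [eventually_ge_atTop 0] with P hP
  rw [hH.Rp_eq, inputCov_smul, smul_mul_conjTranspose_smul, Real.sq_sqrt hP, sub_div]

theorem pinvInflation_smul (t₁ : ℕ) (T₂ : Matrix (Fin t₂) (Fin t₂) ℂ) {s : ℝ} (hs : s ≠ 0) :
    pinvInflation t₁ ((s : ℂ) • T₂) = ((s⁻¹ : ℝ) : ℂ) • pinvInflation t₁ T₂ := by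
  rw [pinvInflation, pinvInflation, pinv_real_smul _ hs]
  ext i (j | j) <;> simp

theorem privateInput_smul (t₁ : ℕ) (T₂ : Matrix (Fin t₂) (Fin t₂) ℂ) (c : ℂ) :
    privateInput t₁ (c • T₂) = c • privateInput t₁ T₂ := by
  ext (i | i) j <;> simp [privateInput]

/-- The pseudo-inverse inflation factor leaves `rank Σ' - rank Σ₂₂` unresolved directions. -/
theorem rank_errorCov_pinvInflation (T₁ : Matrix (TxIndex t₁ t₂) (TxIndex t₁ t₂) ℂ)
    (T₂ : Matrix (Fin t₂) (Fin t₂) ℂ) :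
    (errorCov (T₁ * T₁ᴴ) (privateInput t₁ T₂) (pinvInflation t₁ T₂)).rank =
      (inputCov T₁ T₂).rank - (T₂ * T₂ᴴ).rank := by
  obtain ⟨g1, g2, g3, g4⟩ := pinv_penrose T₂
  obtain ⟨hN, hr⟩ := rank_one_sub_pinv_mul T₂
  have hS := posSemidef_self_mul_conjTranspose T₁
  set E := privateInput t₁ T₂ with hE
  set W := pinvInflation t₁ T₂ with hW
  have hWE : W * E = pinv T₂ * T₂ := by
    rw [hW, hE, pinvInflation, privateInput, fromCols_mul_fromRows, Matrix.mul_zero, zero_add]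
  have hEp : E * (pinv T₂ * T₂) = E := by
    rw [hE, privateInput, fromRows_mul, Matrix.zero_mul, ← Matrix.mul_assoc, g1]
  have hpE : pinv T₂ * T₂ * Eᴴ = Eᴴ := by
    have := congr_arg conjTranspose hEp
    rwa [conjTranspose_mul, g4] at this
  have hWEE : W * (E * Eᴴ) = Eᴴ := by rw [← Matrix.mul_assoc, hWE, hpE]
  have hEW : Eᴴ * Wᴴ = pinv T₂ * T₂ := by rw [← conjTranspose_mul, hWE, g4]
  -- Here `N = 1 - T₂⁺ T₂`, of rank `t₂ - rank T₂`. The hypotheses of the rank identity reduce to `W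
  -- E Eᴴ = Eᴴ`, which holds because `W E` is the orthogonal projection `T₂⁺ T₂`.
  have h := rank_errorCov_add hS E W hN
    (by rw [auxCross, conjTranspose_add, conjTranspose_mul, conjTranspose_conjTranspose, hS.1.eq,
          Matrix.mul_add, hWEE])
    (by rw [auxCov, Matrix.mul_add, Matrix.add_mul, hWEE, hEW]; abel)
  rw [← inputCov_eq, Fintype.card_fin] at h
  rw [rank_self_mul_conjTranspose]
  omega

theorem IsFadingCRC.tendsto_Rc (hH : IsFadingCRC μ H)
    (T₁ : Matrix (TxIndex t₁ t₂) (TxIndex t₁ t₂) ℂ) (T₂ : Matrix (Fin t₂) (Fin t₂) ℂ) :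
    Tendsto (fun P : ℝ => Rc μ H ((√P : ℂ) • T₁) ((√P : ℂ) • T₂)
        (pinvInflation t₁ ((√P : ℂ) • T₂)) / Real.log P) atTop
      (𝓝 (gammaC r₂ (inputCov T₁ T₂).rank (T₂ * T₂ᴴ).rank)) := by
  have hS := posSemidef_self_mul_conjTranspose T₁
  have h1 := tendsto_integral_logDet hH.logMoment_Hbar₂ hH.generic₂ (posSemidef_inputCov T₁ T₂)
  have h2 := tendsto_integral_logDet hH.logMoment_Hbar₂ hH.generic₂
    (posSemidef_errorCov hS (privateInput t₁ T₂) (pinvInflation t₁ T₂))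
  -- The covariance of `U` is independent of the power, so its log-determinant is negligible against
  -- `log P`.
  have h3 : Tendsto (fun P : ℝ => Real.log (auxCov (T₁ * T₁ᴴ) (pinvInflation t₁ T₂)).det.re /
      Real.log P) atTop (𝓝 0) := tendsto_const_nhds.div_atTop Real.tendsto_log_atTop
  rw [rank_errorCov_pinvInflation] at h2
  have h4 := (h1.sub h2).sub h3
  rw [sub_zero] at h4
  refine h4.congr' ?_
  filter_upwards [eventually_gt_atTop 0] with P hP
  have hs : √P ≠ 0 := (Real.sqrt_pos.2 hP).ne'
  rw [hH.Rc_eq, inputCov_smul, smul_mul_conjTranspose_smul, pinvInflation_smul _ _ hs,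
    privateInput_smul, errorCov_scale _ _ _ hs, auxCov_scale _ _ hs, Real.sq_sqrt hP.le, sub_div,
    sub_div]

end Fading

/-! ### Optimal ranks and their realization by feasible matrices. -/

section Attainment

/-- The optimal high-SNR sum-rate scaling in closed form. -/
theorem isGreatest_gamma {t₁ t₂ r₁ r₂ : ℕ} (ht₂ : 0 < t₂) :
    IsGreatest {g : ℝ | ∃ s k : ℕ, AdmissibleRanks t₁ t₂ s k ∧
      g = gammaP r₁ s k + gammaC r₂ s k} ((max (min r₁ (t₁ + t₂)) (min r₂ t₂) : ℕ) : ℝ) := by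
  constructor
  -- Two extreme schemes suffice: only the private cognitive signal, with both ranks `t₂`, or no
  -- private signal and a full-rank joint input.
  · rcases le_total (min r₁ (t₁ + t₂)) (min r₂ t₂) with h | h
    · refine ⟨t₂, t₂, ⟨ht₂, by omega, by simp⟩, ?_⟩
      simp [gammaP, gammaC, max_eq_right h]
    · refine ⟨t₁ + t₂, 0, ⟨by omega, le_rfl, by simp⟩, ?_⟩
      simp [gammaP, gammaC, max_eq_left h]
  · rintro g ⟨s, k, ⟨hs, hst, hk⟩, rfl⟩
    have h : min r₁ s + min r₂ s ≤
        max (min r₁ (t₁ + t₂)) (min r₂ t₂) + min r₁ k + min r₂ (s - k) := by omega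
    have h' : ((min r₁ s : ℕ) : ℝ) + (min r₂ s : ℕ) ≤
        (max (min r₁ (t₁ + t₂)) (min r₂ t₂) : ℕ) + (min r₁ k : ℕ) + (min r₂ (s - k) : ℕ) := by
      exact_mod_cast h
    rw [gammaP, gammaC]
    linarith

theorem diagonal_ite_mul_conjTranspose {n : Type*} [Fintype n] [DecidableEq n] (S : Finset n)
    {q : ℝ} (hq : 0 ≤ q) :
    diagonal (fun i => if i ∈ S then ((√q : ℝ) : ℂ) else 0) *
      (diagonal (fun i => if i ∈ S then ((√q : ℝ) : ℂ) else 0))ᴴ =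
      diagonal (fun i => if i ∈ S then (q : ℂ) else 0) := by
  rw [diagonal_conjTranspose, diagonal_mul_diagonal]
  congr 1
  funext i
  by_cases h : i ∈ S
  · simp [h, ← Complex.ofReal_mul, Real.mul_self_sqrt hq]
  · simp [h]

theorem re_sum_ite_le {n : Type*} [Fintype n] (p : n → Prop) [DecidablePred p] {q : ℝ}
    (hq : 0 ≤ q) : (∑ i, if p i then (q : ℂ) else 0).re ≤ Fintype.card n * q := by
  rw [Complex.re_sum, ← nsmul_eq_mul, ← Finset.card_univ, ← Finset.sum_const]
  refine Finset.sum_le_sum fun i _ => ?_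
  split_ifs <;> simp [hq]

theorem exists_feasible_of_admissibleRanks {t₁ t₂ : ℕ} {κ : ℝ} (hκ : 0 < κ) {s k : ℕ}
    (h : AdmissibleRanks t₁ t₂ s k) :
    ∃ (T₁ : Matrix (TxIndex t₁ t₂) (TxIndex t₁ t₂) ℂ) (T₂ : Matrix (Fin t₂) (Fin t₂) ℂ),
      (inputCov T₁ T₂).rank = s ∧ (T₂ * T₂ᴴ).rank = k ∧
      ∀ P : ℝ, 0 < P → PowerFeasible P (P / κ) ((√P : ℂ) • T₁) ((√P : ℂ) • T₂) := by
  obtain ⟨-, hs, hk⟩ := h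
  obtain ⟨K, -, hK⟩ := Finset.exists_subset_card_eq (s := (Finset.univ : Finset (Fin t₂)))
    (n := k) (by simp; omega)
  -- The support of `Σ` contains that of `Σ₂₂`, so adding the private covariance leaves the rank at
  -- `s`.
  obtain ⟨S, hKS, -, hS⟩ := Finset.exists_subsuperset_card_eq
    (Finset.subset_univ (K.map (Function.Embedding.inr : Fin t₂ ↪ TxIndex t₁ t₂))) (n := s)
    (by simp; omega) (by simpa using hs)
  -- A common power per active antenna. The factor 2 in the second bound accounts for the two
  -- signals, `X₂₁` and `X₂₂`, sharing the cognitive budget `P / κ`.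
  set q : ℝ := min (1 / (t₁ + 1)) (1 / (2 * (t₂ + 1) * κ)) with hq
  have hq0 : 0 < q := lt_min (by positivity) (by positivity)
  have hq1 : t₁ * q ≤ 1 := by
    have h1 : q ≤ 1 / (t₁ + 1) := min_le_left _ _
    rw [le_div_iff₀ (by positivity)] at h1
    nlinarith
  have hq2 : 2 * (t₂ * q) ≤ 1 / κ := by
    have h1 : q ≤ 1 / (2 * (t₂ + 1) * κ) := min_le_right _ _
    rw [le_div_iff₀ (by positivity)] at h1
    rw [le_div_iff₀ hκ]
    nlinarith [mul_pos hq0 hκ]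
  have hqc : (q : ℂ) ≠ 0 := by exact_mod_cast hq0.ne'
  refine ⟨diagonal (fun i => if i ∈ S then ((√q : ℝ) : ℂ) else 0),
    diagonal (fun i => if i ∈ K then ((√q : ℝ) : ℂ) else 0), ?_, ?_, fun P hP => ?_⟩
  · rw [inputCov, diagonal_ite_mul_conjTranspose _ hq0.le, diagonal_ite_mul_conjTranspose _ hq0.le,
      ← diagonal_zero, fromBlocks_diagonal, diagonal_add, rank_diagonal, Fintype.card_subtype, ← hS]
    congr 1
    ext i
    simp only [Finset.mem_filter, Finset.mem_univ, true_and]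
    rcases i with i | i
    · by_cases hi : Sum.inl i ∈ S <;> simp [hi, hqc]
    · by_cases hi : i ∈ K
      · have : Sum.inr i ∈ S := hKS (by simpa using hi)
        simp [hi, this, hqc]
      · by_cases hi' : Sum.inr i ∈ S <;> simp [hi, hi', hqc]
  · rw [diagonal_ite_mul_conjTranspose _ hq0.le, rank_diagonal, Fintype.card_subtype, ← hK]
    congr 1
    ext i
    simp [hqc]
  · rw [PowerFeasible, smul_mul_conjTranspose_smul, smul_mul_conjTranspose_smul, Real.sq_sqrt hP.le,
      diagonal_ite_mul_conjTranspose _ hq0.le, diagonal_ite_mul_conjTranspose _ hq0.le]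
    have e1 := re_sum_ite_le (fun i : Fin t₁ => (Sum.inl i : TxIndex t₁ t₂) ∈ S) hq0.le
    have e2 := re_sum_ite_le (fun i : Fin t₂ => (Sum.inr i : TxIndex t₁ t₂) ∈ S) hq0.le
    have e3 := re_sum_ite_le (fun i : Fin t₂ => i ∈ K) hq0.le
    rw [Fintype.card_fin] at e1 e2 e3
    constructor
    · have : (((P : ℂ) • diagonal (fun i : TxIndex t₁ t₂ => if i ∈ S then (q : ℂ) else 0)).toBlocks₁₁
          ).trace = (P : ℂ) * ∑ i : Fin t₁, if (Sum.inl i : TxIndex t₁ t₂) ∈ S then (q : ℂ) else 0 := by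
        simp [trace, toBlocks₁₁, Finset.mul_sum]
      rw [this, Complex.re_ofReal_mul]
      nlinarith
    · have : (((P : ℂ) • diagonal (fun i : TxIndex t₁ t₂ => if i ∈ S then (q : ℂ) else 0)).toBlocks₂₂
          + (P : ℂ) • diagonal (fun i : Fin t₂ => if i ∈ K then (q : ℂ) else 0)).trace =
          (P : ℂ) * ((∑ i : Fin t₂, if (Sum.inr i : TxIndex t₁ t₂) ∈ S then (q : ℂ) else 0) +
            ∑ i : Fin t₂, if i ∈ K then (q : ℂ) else 0) := by
        simp [trace, toBlocks₂₂, Finset.mul_sum, mul_add, Finset.sum_add_distrib, mul_left_comm]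
      rw [this, Complex.re_ofReal_mul, Complex.add_re, div_eq_mul_one_div]
      gcongr
      linarith

end Attainment

/-! ### The supremum of the sum-rates on the scale `log P`. -/

section Scaling

variable {Ω : Type*} [MeasurableSpace Ω] {μ : Measure Ω} [IsProbabilityMeasure μ]
  {t₁ t₂ r₁ r₂ : ℕ} {H : Ω → ChannelState t₁ t₂ r₁ r₂}

theorem IsFadingCRC.bddAbove_sumRates (hH : IsFadingCRC μ H) (Pp Pc : ℝ) :
    BddAbove (sumRates μ H Pp Pc) := by
  obtain ⟨C, hC⟩ := hH.sumRates_le one_pos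
  exact ⟨_, fun R hR => hC Pp Pc R hR⟩

theorem IsFadingCRC.tendsto_sSup_sumRates (hH : IsFadingCRC μ H) (ht₂ : 0 < t₂) {κ : ℝ}
    (hκ : 0 < κ) :
    Tendsto (fun P : ℝ => sSup (sumRates μ H P (P / κ)) / Real.log P) atTop
      (𝓝 ((max (min r₁ (t₁ + t₂)) (min r₂ t₂) : ℕ) : ℝ)) := by
  obtain ⟨⟨s, k, hsk, hγ⟩, -⟩ := isGreatest_gamma (t₁ := t₁) (r₁ := r₁) (r₂ := r₂) ht₂
  obtain ⟨T₁, T₂, hs, hk, hfeas⟩ := exists_feasible_of_admissibleRanks hκ hsk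
  have hlow := (hH.tendsto_Rp T₁ T₂).add (hH.tendsto_Rc T₁ T₂)
  rw [hs, hk, ← hγ] at hlow
  set γ : ℝ := ((max (min r₁ (t₁ + t₂)) (min r₂ t₂) : ℕ) : ℝ)
  have hmem : ∀ P : ℝ, 0 < P → Rp μ H ((√P : ℂ) • T₁) ((√P : ℂ) • T₂) +
      Rc μ H ((√P : ℂ) • T₁) ((√P : ℂ) • T₂) (pinvInflation t₁ ((√P : ℂ) • T₂)) ∈
      sumRates μ H P (P / κ) := fun P hP => ⟨_, _, _, hfeas P hP, rfl⟩
  refine tendsto_order.2 ⟨fun a ha => ?_, fun b hb => ?_⟩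
  · filter_upwards [hlow.eventually_const_lt ha, eventually_gt_atTop 1] with P hP hP1
    refine hP.trans_le ?_
    rw [← add_div]
    exact div_le_div_of_nonneg_right
      (le_csSup (hH.bddAbove_sumRates _ _) (hmem P (by linarith))) (Real.log_pos hP1).le
  -- Chosen so that `γ + δ t₂ < b`. The total power is `P (1 + 1 / κ)`, whose constant factor is
  -- invisible on the scale `log P`.
  · set δ : ℝ := (b - γ) / (2 * (t₂ + 1)) with hδ
    have hδ0 : 0 < δ := div_pos (by linarith) (by positivity)
    obtain ⟨C, hC⟩ := hH.sumRates_le hδ0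
    have hlim : Tendsto (fun P : ℝ => (γ + δ * t₂) *
        (Real.log (1 + P * (1 + 1 / κ)) / Real.log P) + C / Real.log P) atTop
        (𝓝 ((γ + δ * t₂) * 1 + 0)) := by
      have h1 := tendsto_log_one_add_mul_div_log (x := 1 + 1 / κ) (by positivity)
      rw [if_pos (by positivity)] at h1
      exact (h1.const_mul _).add (tendsto_const_nhds.div_atTop Real.tendsto_log_atTop)
    have hlt : (γ + δ * t₂) * 1 + 0 < b := by
      have h1 : δ * (2 * (t₂ + 1)) = b - γ := by
        rw [hδ]; exact div_mul_cancel₀ _ (by positivity)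
      have h2 : 0 ≤ δ * t₂ := by positivity
      linarith
    filter_upwards [hlim.eventually_lt_const hlt, eventually_gt_atTop 1] with P hP hP1
    refine lt_of_le_of_lt ?_ hP
    have hl := Real.log_pos hP1
    rw [div_le_iff₀ hl]
    have hsup : sSup (sumRates μ H P (P / κ)) ≤
        (γ + δ * t₂) * Real.log (1 + (P + P / κ)) + C :=
      csSup_le ⟨_, hmem P (by linarith)⟩ fun R hR => hC P (P / κ) R hR
    refine hsup.trans_eq ?_
    have e : P * (1 + 1 / κ) = P + P / κ := by ring
    rw [e]
    field_simp

end Scaling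

theorem theorem2 {Ω : Type*} [MeasurableSpace Ω] (μ : Measure Ω) [IsProbabilityMeasure μ]
    (t₁ t₂ r₁ r₂ : ℕ) (ht₁ : 0 < t₁) (ht₂ : 0 < t₂) (hr₁ : 0 < r₁) (hr₂ : 0 < r₂)
    (H : Ω → ChannelState t₁ t₂ r₁ r₂) (hH : IsFadingCRC μ H)
    (κ : ℝ) (hκ : 0 < κ) :
    ∃ γsum : ℝ,
      -- `γsum` is the maximum of `γ_p + γ_c` over the admissible ranks
      IsGreatest {g : ℝ | ∃ s k : ℕ, AdmissibleRanks t₁ t₂ s k ∧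
        g = gammaP r₁ s k + gammaC r₂ s k} γsum ∧
      -- the rates of every scheme are genuine expectations
      (∀ (T₁ : Matrix (TxIndex t₁ t₂) (TxIndex t₁ t₂) ℂ) (T₂ : Matrix (Fin t₂) (Fin t₂) ℂ)
        (W : Matrix (Fin t₂) (TxIndex t₁ t₂) ℂ),
        Integrable (fun ω => (H ω).primaryRate T₁ T₂) μ ∧
        Integrable (fun ω => (H ω).cognitiveRate T₁ T₂ W) μ) ∧
      -- the best sum-rate over covariances and inflation factors, with `P_p / P_c = κ`, scales
      -- as `γsum * log P_p`
      (∀ P : ℝ, 0 < P → BddAbove (sumRates μ H P (P / κ))) ∧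
      Tendsto (fun P : ℝ => sSup (sumRates μ H P (P / κ)) / Real.log P) atTop (𝓝 γsum) ∧
      -- for given covariances scaled with the power, `W = [0 T₂⁺]` achieves `γ_p` and `γ_c`
      (∀ (T₁ : Matrix (TxIndex t₁ t₂) (TxIndex t₁ t₂) ℂ) (T₂ : Matrix (Fin t₂) (Fin t₂) ℂ),
        Tendsto (fun P : ℝ => Rp μ H ((√P : ℂ) • T₁) ((√P : ℂ) • T₂) / Real.log P) atTop
          (𝓝 (gammaP r₁ (inputCov T₁ T₂).rank (T₂ * T₂ᴴ).rank)) ∧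
        Tendsto (fun P : ℝ => Rc μ H ((√P : ℂ) • T₁) ((√P : ℂ) • T₂)
            (pinvInflation t₁ ((√P : ℂ) • T₂)) / Real.log P) atTop
          (𝓝 (gammaC r₂ (inputCov T₁ T₂).rank (T₂ * T₂ᴴ).rank))) ∧
      -- and all admissible ranks are attained within the power constraints
      (∀ s k : ℕ, AdmissibleRanks t₁ t₂ s k →
        ∃ (T₁ : Matrix (TxIndex t₁ t₂) (TxIndex t₁ t₂) ℂ) (T₂ : Matrix (Fin t₂) (Fin t₂) ℂ),
          (inputCov T₁ T₂).rank = s ∧ (T₂ * T₂ᴴ).rank = k ∧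
          ∀ P : ℝ, 0 < P → PowerFeasible P (P / κ) ((√P : ℂ) • T₁) ((√P : ℂ) • T₂)) := by
  exact ⟨_, isGreatest_gamma ht₂,
    fun T₁ T₂ W => ⟨hH.integrable_primaryRate T₁ T₂, hH.integrable_cognitiveRate T₁ T₂ W⟩,
    fun P _ => hH.bddAbove_sumRates _ _, hH.tendsto_sSup_sumRates ht₂ hκ,
    fun T₁ T₂ => ⟨hH.tendsto_Rp T₁ T₂, hH.tendsto_Rc T₁ T₂⟩,
    fun s k h => exists_feasible_of_admissibleRanks hκ h⟩
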